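/- **Conventions.** Banach spaces are over $\mathbb K=\mathbb R$ or $\mathbb C$. A sequence $(x_k)$ in a Banach space $Z$ is *$\Delta$-convergent* to $x$, written $x_k\rightharpoondown x$, if $\limsup_k(\|x_k-x\|-\|x_k-y\|)\le 0$ for every $y\in Z$. For operators, $g_k\rightharpoonup 0$ means $g_kz\rightharpoonup 0$ weakly for each $z\in Z$. The modulus of convexity of $Z$ is $\delta(\epsilon)=\inf\{1-\|\tfrac{x+y}{2}\|:\ \|x\|=\|y\|=1,\ \|x-y\|=\epsilon\}$, $0\le\epsilon\le 2$ (with value $0$ if there are no such $x,y$). A group $D_0$ of bijective linear isometries of $Z$ is a *dislocation group* on $Z$ if 1. for every sequence $(g_k)\subset D_0$ with $g_k\not\rightharpoonup 0$ there is a subsequence along which both $g_{k_j}$ and $g_{k_j}^{-1}$ converge pointwise in norm; and 2. $u_k\rightharpoondown 0$, $w\in Z$, $(g_k)\subset D_0$, $g_k\rightharpoonup 0$ imply $u_k+g_kw\rightharpoondown 0$. For a set $D$ of isometries with $\mathrm{Id}\in D$, a sequence $(r_k)$ is *$D$-$\Delta$-null* (resp. *$D$-weakly null*) if $g_k^{-1}r_k\rightharpoondown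 0$ (resp. $g_k^{-1}r_k\rightharpoonup 0$) for every sequence $(g_k)\subset D$. A bounded sequence $(u_k)\subset Z$ admits a *$\Delta$-profile decomposition* in $Z$ relative to $D$ if, after passing to a subsequence of $(u_k)$ (not relabelled), there are a finite or countably infinite number $N\ge1$ of profiles $w^{(n)}\in Z$ and sequences $(g^{(n)}_k)_k\subset D$ ($1\le n\le N$, or $n\ge 1$ if $N=\infty$) with $g^{(1)}_k=\mathrm{Id}$ and $(g^{(n)}_k)^{-1}g^{(m)}_k\rightharpoonup 0$ for $m\ne n$, and a $D$-$\Delta$-null sequence $(r_k)$, such that $u_k=\sum_n g_k^{(n)}w^{(n)}+r_k$ for every $k$, the series converging in norm unconditionally and uniformly in $k$. Profiles may be zero. $Z$ satisfies *Opial's condition* if $x_k\rightharpoonup x_0$ weakly implies $\liminf\|x_k-x_0\|\le\liminf\|x_k-x\|$ for all $x\in Z$. **Theorem.** Let $X$ be a Banach space continuously, injectively and densely embedded into a uniformly convex and uniformly smooth Banach space $Y$. Let $D_0$ be a dislocation group on $Y$ each of whose elements restricts to a bijective isometry of $X$, such that the group of restrictions is a dislocation group on $X$, and let $D\subset D_0$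 with $\mathrm{Id}\in D$. Let $(u_k)$ be a bounded sequence in $X$. Then $(u_k)$ admits a $\Delta$-profile decomposition in $Y$ relative to $D$. Moreover, for every such decomposition (along the corresponding subsequence of $(u_k)$), one has $(g^{(n)}_k)^{-1}u_k\rightharpoondown w^{(n)}$ in $Y$ for each of its profiles, and: * if $\|u_k\|_Y\le 1$ for all $k$ and $\delta$ is the modulus of convexity of $Y$, then $\|w^{(n)}\|_Y\le 2$ for all $n$ and $$\limsup_{k}\|r_k\|_Y+\sum_n\delta(\|w^{(n)}\|_Y)\le 1;$$ * if only finitely many $w^{(n)}$ are nonzero, $Y$ satisfies Opial's condition and $X$ is $D$-cocompactly embedded into $Y$, then $\|r_k\|_Y\to 0$. Here $X$ is *$D$-cocompactly embedded* into $Y$ if either (a) every sequence $(x_k)$ that is bounded in $X$ and $D$-weakly convergent in $Y$ (i.e. $x_k-y$ is $D$-weakly null in $Y$ for some $y\in Y$) converges in the norm of $Y$; or (b) $Y^*$ is dense in $X^*$ and every sequence in $X$ that is $D$-weakly null in $X$ (with respect to the restrictions of $D$ to $X$) converges to $0$ in the norm of $Y$. -/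

import Mathlib

open Filter Topology

/-- `u k ⇀ x`: weak convergence of a sequence. -/
def WeakTendsto (𝕜 : Type*) {Z : Type*} [RCLike 𝕜] [NormedAddCommGroup Z] [NormedSpace 𝕜 Z]
    (u : ℕ → Z) (x : Z) : Prop :=
  ∀ f : StrongDual 𝕜 Z, Tendsto (fun k => f (u k)) atTop (𝓝 (f x))

/-- `x` is a `Δ`-limit of `u`: for every `y`, `‖u k - x‖ ≤ ‖u k - y‖ + o(1)`. -/
def DeltaTendsto {Z : Type*} [NormedAddCommGroup Z] (u : ℕ → Z) (x : Z) : Prop :=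
  ∀ y : Z, ∀ ε : ℝ, 0 < ε → ∀ᶠ k in atTop, ‖u k - x‖ ≤ ‖u k - y‖ + ε

/-- `g k ⇀ 0`: weak operator convergence of a sequence of isometries to the zero operator. -/
def WeakOpNull {𝕜 Z : Type*} [RCLike 𝕜] [NormedAddCommGroup Z] [NormedSpace 𝕜 Z]
    (g : ℕ → (Z ≃ₗᵢ[𝕜] Z)) : Prop :=
  ∀ z : Z, WeakTendsto 𝕜 (fun k => g k z) 0

/-- Modulus of convexity: the infimum of `1 - ‖(x + y) / 2‖` over unit vectors `x`, `y` with
`‖x - y‖ = ε`. -/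
noncomputable def convexityModulus (Z : Type*) [NormedAddCommGroup Z] (ε : ℝ) : ℝ :=
  sInf {t : ℝ | ∃ x y : Z, ‖x‖ = 1 ∧ ‖y‖ = 1 ∧ ‖x - y‖ = ε ∧ t = 1 - ‖x + y‖ / 2}

/-- Uniformly smooth normed spaces. -/
def IsUniformlySmooth (Z : Type*) [NormedAddCommGroup Z] : Prop :=
  ∀ ε : ℝ, 0 < ε → ∃ δ : ℝ, 0 < δ ∧
    ∀ x y : Z, ‖x‖ = 1 → ‖y‖ ≤ δ → ‖x + y‖ + ‖x - y‖ ≤ 2 + ε * ‖y‖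

/-- Opial's condition (with non-strict inequality). -/
def SatisfiesOpial (𝕜 Z : Type*) [RCLike 𝕜] [NormedAddCommGroup Z] [NormedSpace 𝕜 Z] : Prop :=
  ∀ (u : ℕ → Z) (x₀ : Z), WeakTendsto 𝕜 u x₀ →
    ∀ x : Z, liminf (fun k => ‖u k - x₀‖) atTop ≤ liminf (fun k => ‖u k - x‖) atTop

/-- A group of bijective linear isometries of `Z` is a dislocation group if
* every sequence in it which does not converge weakly to `0` has a subsequence along which both
  the operators and their inverses converge pointwise in norm, and
* adding `g k w`, with `g k ⇀ 0`, to a sequence `Δ`-converging to `0` does not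
  destroy `Δ`-convergence to `0`. -/
structure IsDislocationGroup {𝕜 Z : Type*} [RCLike 𝕜] [NormedAddCommGroup Z] [NormedSpace 𝕜 Z]
    (D₀ : Subgroup (Z ≃ₗᵢ[𝕜] Z)) : Prop where
  exists_strong_limit : ∀ g : ℕ → (Z ≃ₗᵢ[𝕜] Z), (∀ k, g k ∈ D₀) → ¬ WeakOpNull g →
    ∃ φ : ℕ → ℕ, StrictMono φ ∧
      (∀ z, ∃ l, Tendsto (fun j => (g (φ j))⁻¹ z) atTop (𝓝 l)) ∧
      (∀ z, ∃ l, Tendsto (fun j => g (φ j) z) atTop (𝓝 l))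
  deltaTendsto_add : ∀ (u : ℕ → Z) (w : Z) (g : ℕ → (Z ≃ₗᵢ[𝕜] Z)), DeltaTendsto u 0 →
    (∀ k, g k ∈ D₀) → WeakOpNull g → DeltaTendsto (fun k => u k + g k w) 0

/-- `u` is `D`-weakly null: `(g k)⁻¹ (u k) ⇀ 0` for every sequence `g` in `D`. -/
def DWeakNull {𝕜 Z : Type*} [RCLike 𝕜] [NormedAddCommGroup Z] [NormedSpace 𝕜 Z]
    (D : Set (Z ≃ₗᵢ[𝕜] Z)) (u : ℕ → Z) : Prop :=
  ∀ g : ℕ → (Z ≃ₗᵢ[𝕜] Z), (∀ k, g k ∈ D) → WeakTendsto 𝕜 (fun k => (g k)⁻¹ (u k)) 0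

/-- `u` is `D`-`Δ`-null: `(g k)⁻¹ (u k)` `Δ`-converges to `0` for every sequence `g` in `D`. -/
def DDeltaNull {𝕜 Z : Type*} [RCLike 𝕜] [NormedAddCommGroup Z] [NormedSpace 𝕜 Z]
    (D : Set (Z ≃ₗᵢ[𝕜] Z)) (u : ℕ → Z) : Prop :=
  ∀ g : ℕ → (Z ≃ₗᵢ[𝕜] Z), (∀ k, g k ∈ D) → DeltaTendsto (fun k => (g k)⁻¹ (u k)) 0

/-- A `Δ`-profile decomposition of the sequence `u` relative to `D`, along the subsequence `φ`,
with gauges `g n k` (the `n`-th gauge at time `k`), profiles `w n` and remainder `r`. There are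
`N` profile slots, `1 ≤ N ≤ ∞`, numbered from `0`; for finite `N` the sum is a finite one. -/
structure IsDeltaProfileDecomposition {𝕜 Z : Type*} [RCLike 𝕜] [NormedAddCommGroup Z]
    [NormedSpace 𝕜 Z] (D : Set (Z ≃ₗᵢ[𝕜] Z)) (u : ℕ → Z) (φ : ℕ → ℕ) (N : ℕ∞)
    (g : ℕ → ℕ → (Z ≃ₗᵢ[𝕜] Z)) (w : ℕ → Z) (r : ℕ → Z) : Prop where
  strictMono : StrictMono φ
  one_le : 1 ≤ N
  mem : ∀ n k, g n k ∈ D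
  first_eq_one : ∀ k, g 0 k = 1
  profile_eq_zero : ∀ n : ℕ, N ≤ (n : ℕ∞) → w n = 0
  decoupled : ∀ m n : ℕ, (m : ℕ∞) < N → (n : ℕ∞) < N → m ≠ n →
    WeakOpNull (fun k => (g n k)⁻¹ * g m k)
  /-- `u (φ k) = ∑ n, g n k (w n) + r k`, the series converging unconditionally (along the
  directed set of all finite sets of indices) and uniformly in `k`. -/
  sum : TendstoUniformly (fun (s : Finset ℕ) (k : ℕ) => ∑ n ∈ s, g n k (w n))
    (fun k => u (φ k) - r k) atTop
  remainder : DDeltaNull D r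

section Embedding

variable {𝕜 X Y : Type*} [RCLike 𝕜] [NormedAddCommGroup X] [NormedSpace 𝕜 X]
  [NormedAddCommGroup Y] [NormedSpace 𝕜 Y]

/-- The bijective isometry `h` of `X` is the restriction to `X` of the isometry `g` of `Y`,
where `X` is regarded as a subspace of `Y` through `ι`. -/
def IsRestriction (ι : X →L[𝕜] Y) (g : Y ≃ₗᵢ[𝕜] Y) (h : X ≃ₗᵢ[𝕜] X) : Prop :=
  ∀ x, ι (h x) = g (ι x)

/-- The set of restrictions to `X` of the elements of `D`. -/
def restrictSet (ι : X →L[𝕜] Y) (D : Set (Y ≃ₗᵢ[𝕜] Y)) : Set (X ≃ₗᵢ[𝕜] X) :=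
  {h | ∃ g ∈ D, IsRestriction ι g h}

/-- The group of restrictions to `X` of the elements of the group `D₀`. -/
def restrictGroup (ι : X →L[𝕜] Y) (D₀ : Subgroup (Y ≃ₗᵢ[𝕜] Y)) : Subgroup (X ≃ₗᵢ[𝕜] X) where
  carrier := restrictSet ι (D₀ : Set (Y ≃ₗᵢ[𝕜] Y))
  one_mem' := ⟨1, D₀.one_mem, fun _ => rfl⟩
  mul_mem' := by
    rintro a b ⟨g, hg, ha⟩ ⟨g', hg', hb⟩
    refine ⟨g * g', D₀.mul_mem hg hg', fun x => ?_⟩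
    have h1 : (a * b) x = a (b x) := rfl
    have h2 : (g * g') (ι x) = g (g' (ι x)) := rfl
    rw [h1, h2, ha, hb]
  inv_mem' := by
    rintro a ⟨g, hg, ha⟩
    refine ⟨g⁻¹, D₀.inv_mem hg, fun x => ?_⟩
    have h1 : a (a⁻¹ x) = x := a.apply_symm_apply x
    have h2 : g⁻¹ (g (ι (a⁻¹ x))) = ι (a⁻¹ x) := g.symm_apply_apply _
    rw [← h2, ← ha, h1]

/-- `B ⊆ Y` is `D`-cocompact: every `D`-weakly convergent sequence in `B` converges in norm. -/
def IsCocompactSet (D : Set (Y ≃ₗᵢ[𝕜] Y)) (B : Set Y) : Prop :=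
  ∀ u : ℕ → Y, (∀ k, u k ∈ B) → ∀ y : Y, DWeakNull D (fun k => u k - y) →
    ∃ l, Tendsto u atTop (𝓝 l)

/-- The embedding `ι` is cocompact relative to a set `D` of isometries of `X`: every `D`-weakly
null sequence in `X` converges to `0` in the norm of `Y`. -/
def IsCocompactEmbedding (ι : X →L[𝕜] Y) (D : Set (X ≃ₗᵢ[𝕜] X)) : Prop :=
  ∀ u : ℕ → X, DWeakNull D u → Tendsto (fun k => ι (u k)) atTop (𝓝 0)

/-- Cocompactness of the embedding `ι` relative to a set `D` of isometries of `Y` restricting to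
`X`: either all bounded subsets of `X` are `D`-cocompact in `Y`, or the dual space of `Y` is dense
in the dual space of `X` and `ι` is cocompact relative to the restrictions of `D` to `X`. -/
def IsDCocompact (ι : X →L[𝕜] Y) (D : Set (Y ≃ₗᵢ[𝕜] Y)) : Prop :=
  (∀ B : Set X, Bornology.IsBounded B → IsCocompactSet D (ι '' B)) ∨
  (DenseRange (fun f : StrongDual 𝕜 Y => f.comp ι) ∧
    IsCocompactEmbedding ι (restrictSet ι D))

end Embedding

/-! ### Uniform convexity and the modulus of convexity in balls. -/

section Convexity

variable {E : Type*} [NormedAddCommGroup E] [NormedSpace ℝ E]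

/-! Existence rests on greedy extraction. In a complete uniformly convex space asymptotic centres
are unique, and every bounded sequence has a `Δ`-convergent subsequence (`exists_le_deltaAlong`).
The first gauge is the identity; every later profile has at least half the largest norm still
available.

The dislocation axioms act through two facts. If one sequence has a zero profile along `h` and a
nonzero one along `g`, then `h⁻¹ g ⇀ 0` (`weakOpNull_inv_mul`). Concentrations along transversal
gauges do not disturb a `Δ`-limit `0` (`deltaTendsto_inv_add_sum`). Hence removing more
concentrations lowers the limiting norm of the residual. Near the infimum of these norms uniform
convexity forces sums of far terms to be small (`exists_forall_eventually_norm_sum_le`), and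
changing finitely many gauges of each profile makes this uniform in `k`
(`exists_forall_norm_sum_max_le`). A nonzero profile of the remainder would also be a profile of
every residual, so greed would bound it by `2 * ‖w m‖` for all `m ≥ 1`, although `w m → 0`
(`dDeltaNull_of_approx`).

For an arbitrary decomposition, the `Δ`-limit `w` of `g⁻¹ v` is compared with `w / 2`:
asymptotically `v - g w` is no longer than its midpoint with `v`, so removing `g w` costs at least
`δ(‖w‖)` of norm (`energy_step`). Iteration gives the energy inequality.

Under Opial's condition `Δ`-limits are weak limits (`SatisfiesOpial.weakTendsto`). The profiles then
lie in the `Y`-closure of a ball of `X`; replacing them by points of that ball turns the remainder,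
up to an error vanishing in `Y`, into a bounded sequence of `X`, to which cocompactness applies. -/

/-- Translating a pair of points in the direction of their sum. -/
theorem exists_translate_norm_add_eq {x y : E} (h : x ≠ y) {t : ℝ} (ht : 0 ≤ t) :
    ∃ z : E, ‖z‖ = t ∧ ‖(x + z) + (y + z)‖ = ‖x + y‖ + 2 * t := by
  by_cases h0 : x + y = 0
  · have hn : ‖x - y‖ ≠ 0 := norm_ne_zero_iff.2 (sub_ne_zero.2 h)
    have hz : ‖(t / ‖x - y‖) • (x - y)‖ = t := by
      rw [norm_smul, norm_div, norm_norm, Real.norm_of_nonneg ht, div_mul_cancel₀ _ hn]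
    refine ⟨(t / ‖x - y‖) • (x - y), hz, ?_⟩
    generalize (t / ‖x - y‖) • (x - y) = z at hz
    have : x + z + (y + z) = (x + y) + (2 : ℝ) • z := by rw [two_smul]; abel
    rw [this, h0, zero_add, norm_smul, hz]
    simp
  · have hn : ‖x + y‖ ≠ 0 := norm_ne_zero_iff.2 h0
    refine ⟨(t / ‖x + y‖) • (x + y), ?_, ?_⟩
    · rw [norm_smul, norm_div, norm_norm, Real.norm_of_nonneg ht, div_mul_cancel₀ _ hn]
    · have : x + (t / ‖x + y‖) • (x + y) + (y + (t / ‖x + y‖) • (x + y))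
          = (1 + 2 * (t / ‖x + y‖)) • (x + y) := by
        module
      rw [this, norm_smul, Real.norm_of_nonneg (by positivity)]
      field_simp

/-- Uniform convexity in balls of varying radius. -/
theorem exists_forall_norm_half_add_le [UniformConvexSpace E] (R₀ : ℝ) {ε : ℝ} (hε : 0 < ε) :
    ∃ η : ℝ, 0 < η ∧ ∀ R : ℝ, R ≤ R₀ → ∀ x y : E, ‖x‖ ≤ R + η → ‖y‖ ≤ R + η → ε ≤ ‖x - y‖ →
      ‖x + y‖ / 2 ≤ R - η := by
  obtain ⟨δ, hδ, h⟩ := exists_forall_closed_ball_dist_add_le_two_mul_sub E hε (R₀ + 1)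
  have h1 : min 1 (δ / 4) ≤ 1 := min_le_left _ _
  have h2 : min 1 (δ / 4) ≤ δ / 4 := min_le_right _ _
  refine ⟨min 1 (δ / 4), by positivity, fun R hR x y hx hy hxy => ?_⟩
  have hne : x ≠ y := by
    rintro rfl
    simp at hxy
    linarith
  -- Translation moves both points into the ball of radius `R₀ + 1`, keeps their difference and adds
  -- exactly `2t` to the norm of the sum. The gap `δ` there absorbs the loss since `4η ≤ δ`.
  obtain ⟨z, hz, hs⟩ := exists_translate_norm_add_eq hne
    (show 0 ≤ R₀ + 1 - (R + min 1 (δ / 4)) by linarith)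
  have := h (x := x + z) (by linarith [norm_add_le x z]) (y := y + z)
    (by linarith [norm_add_le y z]) (by simpa using hxy)
  linarith

theorem convexityModulus_nonneg {E : Type*} [NormedAddCommGroup E] (ε : ℝ) : 0 ≤ convexityModulus E ε := by
  refine Real.sInf_nonneg ?_
  rintro t ⟨x, y, hx, hy, -, rfl⟩
  linarith [norm_add_le x y]

theorem convexityModulus_le {E : Type*} [NormedAddCommGroup E] {x y : E} (hx : ‖x‖ = 1) (hy : ‖y‖ = 1) :
    convexityModulus E ‖x - y‖ ≤ 1 - ‖x + y‖ / 2 := by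
  refine csInf_le ⟨0, ?_⟩ ⟨x, y, hx, hy, rfl, rfl⟩
  rintro t ⟨x, y, hx, hy, -, rfl⟩
  linarith [norm_add_le x y]

theorem convexityModulus_le_one {E : Type*} [NormedAddCommGroup E] (ε : ℝ) : convexityModulus E ε ≤ 1 := by
  by_cases h : ∃ x y : E, ‖x‖ = 1 ∧ ‖y‖ = 1 ∧ ‖x - y‖ = ε
  · obtain ⟨x, y, hx, hy, rfl⟩ := h
    linarith [convexityModulus_le hx hy, norm_nonneg (x + y)]
  · have : {t : ℝ | ∃ x y : E, ‖x‖ = 1 ∧ ‖y‖ = 1 ∧ ‖x - y‖ = ε ∧ t = 1 - ‖x + y‖ / 2} = ∅ := by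
      ext t
      simp only [Set.mem_ofPred_eq, Set.mem_empty_iff_false, iff_false]
      rintro ⟨x, y, hx, hy, hxy, -⟩
      exact h ⟨x, y, hx, hy, hxy⟩
    rw [convexityModulus, this, Real.sInf_empty]
    exact zero_le_one

@[simp]
theorem convexityModulus_zero : convexityModulus E 0 = 0 := by
  refine le_antisymm ?_ (convexityModulus_nonneg 0)
  by_cases h : ∃ x : E, ‖x‖ = 1
  · obtain ⟨x, hx⟩ := h
    have := convexityModulus_le hx hx
    rw [sub_self, norm_zero, ← two_smul ℝ x, norm_smul, hx] at this
    simpa using this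
  · have : {t : ℝ | ∃ x y : E, ‖x‖ = 1 ∧ ‖y‖ = 1 ∧ ‖x - y‖ = 0 ∧ t = 1 - ‖x + y‖ / 2} = ∅ := by
      ext t
      simp only [Set.mem_ofPred_eq, Set.mem_empty_iff_false, iff_false]
      rintro ⟨x, y, hx, -⟩
      exact h ⟨x, hx⟩
    rw [convexityModulus, this, Real.sInf_empty]

/-- A point of the closed unit ball can be pushed to the unit sphere in any direction. -/
theorem exists_nonneg_norm_add_smul_eq_one {x v : E} (hx : ‖x‖ ≤ 1) (hv : v ≠ 0) :
    ∃ s : ℝ, 0 ≤ s ∧ ‖x + s • v‖ = 1 := by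
  have hn : 0 < ‖v‖ := norm_pos_iff.2 hv
  have hb : (0 : ℝ) ≤ 2 / ‖v‖ := by positivity
  have hc : ContinuousOn (fun s : ℝ => ‖x + s • v‖) (Set.Icc 0 (2 / ‖v‖)) := by fun_prop
  have h2 : 1 ≤ ‖x + (2 / ‖v‖) • v‖ := by
    have h3 : ‖(2 / ‖v‖) • v‖ = 2 := by
      rw [norm_smul, Real.norm_of_nonneg hb, div_mul_cancel₀ _ hn.ne']
    have h4 := norm_sub_le (x + (2 / ‖v‖) • v) x
    rw [add_sub_cancel_left, h3] at h4
    linarith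
  obtain ⟨s, hs, hs'⟩ := intermediate_value_Icc hb hc
    (show (1 : ℝ) ∈ Set.Icc _ _ from ⟨by simpa using hx, h2⟩)
  exact ⟨s, hs.1, hs'⟩

/-- Moving one of two points of the unit sphere along the arc towards the other one, one can
prescribe their distance without decreasing the norm of their sum. -/
theorem convexityModulus_le_of_le_norm_sub {x y : E} (hx : ‖x‖ = 1) (hy : ‖y‖ = 1) {ε : ℝ}
    (hε : 0 ≤ ε) (hxy : ε ≤ ‖x - y‖) : convexityModulus E ε ≤ 1 - ‖x + y‖ / 2 := by
  by_cases h0 : x + y = 0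
  · rw [h0]
    simpa using convexityModulus_le_one (E := E) ε
  obtain ⟨f, hf, hfxy⟩ := exists_dual_vector ℝ (x + y) (norm_ne_zero_iff.2 h0)
  have hle : ∀ z, f z ≤ ‖z‖ := fun z =>
    (le_abs_self _).trans (by simpa [hf] using f.le_opNorm z)
  have hfxy' : f x + f y = ‖x + y‖ := by rw [← map_add, hfxy]; simp
  -- The point with the smaller value of `f` is the one to be moved, so that `f` of the sum does not
  -- decrease.
  wlog hyx : f y ≤ f x generalizing x y
  · have := this hy hx (by rwa [norm_sub_rev]) (by rwa [add_comm]) (by rwa [add_comm])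
      (by rwa [add_comm, add_comm y]) (le_of_not_ge hyx)
    rwa [add_comm]
  set p : ℝ → E := fun τ => (1 - τ) • y + τ • x with hp
  have hnp : ∀ τ ∈ Set.Icc (0 : ℝ) 1, |1 - 2 * τ| ≤ ‖p τ‖ := by
    rintro τ ⟨hτ0, hτ1⟩
    have := abs_norm_sub_norm_le ((1 - τ) • y) (-(τ • x))
    rw [norm_neg, norm_smul, norm_smul, hx, hy, sub_neg_eq_add, Real.norm_of_nonneg hτ0,
      Real.norm_of_nonneg (by linarith)] at this
    calc |1 - 2 * τ| = |(1 - τ) * 1 - τ * 1| := by ring_nf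
      _ ≤ _ := this
  have hp0 : ∀ τ ∈ Set.Icc (0 : ℝ) 1, ‖p τ‖ ≠ 0 := by
    intro τ hτ h
    have h1 := hnp τ hτ
    rw [h] at h1
    have h2 : 1 - 2 * τ = 0 := abs_eq_zero.1 (le_antisymm h1 (abs_nonneg _))
    have h3 : τ = 1 / 2 := by linarith
    have h4 : p τ = (1 / 2 : ℝ) • (x + y) := by
      rw [hp, h3]
      module
    rw [h4, norm_smul] at h
    simp [h0] at h
  have hp1 : ∀ τ ∈ Set.Icc (0 : ℝ) 1, ‖p τ‖ ≤ 1 := by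
    rintro τ ⟨hτ0, hτ1⟩
    have := norm_add_le ((1 - τ) • y) (τ • x)
    rw [norm_smul, norm_smul, hx, hy, Real.norm_of_nonneg hτ0,
      Real.norm_of_nonneg (by linarith)] at this
    simpa [hp] using this
  set q : ℝ → E := fun τ => ‖p τ‖⁻¹ • p τ with hq
  have hpc : Continuous p := by fun_prop
  have hqc : ContinuousOn (fun τ => ‖x - q τ‖) (Set.Icc 0 1) :=
    (continuousOn_const.sub ((hpc.norm.continuousOn.inv₀ hp0).smul hpc.continuousOn)).norm
  have hq0 : q 0 = y := by simp [hq, hp, hy]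
  have hq1 : q 1 = x := by simp [hq, hp, hx]
  obtain ⟨τ, hτ, hτε⟩ := intermediate_value_Icc' zero_le_one hqc
    (show ε ∈ Set.Icc _ _ from ⟨by simpa [hq1] using hε, by simpa [hq0] using hxy⟩)
  have hqn : ‖q τ‖ = 1 := by
    rw [hq]
    simp only [norm_smul, norm_inv, norm_norm]
    exact inv_mul_cancel₀ (hp0 τ hτ)
  have hfq : f y ≤ f (q τ) := by
    have hpos : 0 < ‖p τ‖ := lt_of_le_of_ne (norm_nonneg _) (hp0 τ hτ).symm
    have hfx := hle x
    have hfy := hle y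
    rw [hx] at hfx
    rw [hy] at hfy
    have e1 : f (q τ) = ((1 - τ) * f y + τ * f x) / ‖p τ‖ := by
      simp [hq, hp, div_eq_inv_mul, mul_add]
    rw [e1, le_div_iff₀ hpos]
    have hsum : 0 ≤ f x + f y := by rw [hfxy']; positivity
    have h1 := (le_abs_self _).trans (hnp τ hτ)
    have h2 := hp1 τ hτ
    obtain ⟨hτ0, hτ1⟩ := hτ
    -- For `f y ≥ 0`, normalizing by `‖p τ‖ ≤ 1` only helps. For `f y < 0`, it suffices that `‖p τ‖
    -- ≥ 1 - 2τ` and `f x ≥ -f y`.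
    by_cases hneg : 0 ≤ f y
    · nlinarith [mul_nonneg hneg (sub_nonneg.2 h2), mul_nonneg hτ0 (sub_nonneg.2 hyx)]
    · push Not at hneg
      nlinarith [mul_nonneg hτ0 hsum, mul_nonneg (neg_nonneg.2 hneg.le) (sub_nonneg.2 h1)]
  have hfin := convexityModulus_le hx hqn
  simp only at hτε
  rw [hτε] at hfin
  have := hle (x + q τ)
  rw [map_add] at this
  linarith

/-- The modulus of convexity controls pairs of points of the closed unit ball. -/
theorem convexityModulus_le_of_norm_le_one {x y : E} (hx : ‖x‖ ≤ 1) (hy : ‖y‖ ≤ 1) :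
    convexityModulus E ‖x - y‖ ≤ 1 - ‖x + y‖ / 2 := by
  by_cases h0 : x + y = 0
  · rw [h0]
    simpa using convexityModulus_le_one (E := E) ‖x - y‖
  obtain ⟨f, hf, hfxy⟩ := exists_dual_vector ℝ (x + y) (norm_ne_zero_iff.2 h0)
  have hle : ∀ z, f z ≤ ‖z‖ := fun z =>
    (le_abs_self _).trans (by simpa [hf] using f.le_opNorm z)
  have hfxy' : f (x + y) = ‖x + y‖ := by simpa using hfxy
  by_cases hker : ∃ v, v ≠ 0 ∧ f v = 0
  · obtain ⟨v, hv, hfv⟩ := hker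
    have key : ∀ v : E, f v = 0 → ∀ s t : ℝ, ‖x + s • v‖ = 1 → ‖y + t • (-v)‖ = 1 →
        ‖x - y‖ ≤ ‖x + s • v - (y + t • (-v))‖ →
        convexityModulus E ‖x - y‖ ≤ 1 - ‖x + y‖ / 2 := by
      intro v hfv s t hs ht hle'
      have h1 := convexityModulus_le_of_le_norm_sub hs ht (norm_nonneg _) hle'
      have h2 := hle (x + s • v + (y + t • (-v)))
      have h3 : f (x + s • v + (y + t • (-v))) = ‖x + y‖ := by
        rw [← hfxy']
        simp [hfv]
      linarith
    -- Pushing `x` and `y` to the sphere in opposite directions of `ker f` preserves `f (x + y)`.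
    -- Since `x - y` is a convex combination of the two possible new differences, one of the two
    -- choices does not shorten it.
    obtain ⟨s, hs0, hs⟩ := exists_nonneg_norm_add_smul_eq_one hx hv
    obtain ⟨t, ht0, ht⟩ := exists_nonneg_norm_add_smul_eq_one hy (neg_ne_zero.2 hv)
    obtain ⟨s', hs0', hs'⟩ := exists_nonneg_norm_add_smul_eq_one hx (neg_ne_zero.2 hv)
    obtain ⟨t', ht0', ht'⟩ := exists_nonneg_norm_add_smul_eq_one hy hv
    by_cases h : ‖x - y‖ ≤ ‖x + s • v - (y + t • (-v))‖
    · exact key v hfv s t hs ht h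
    refine key (-v) (by simp [hfv]) s' t' hs' (by rwa [neg_neg]) ?_
    have hst : 0 ≤ s + t := by positivity
    have hst' : 0 ≤ s' + t' := by positivity
    have e1 : x + s • v - (y + t • (-v)) = (x - y) + (s + t) • v := by module
    have e2 : x + s' • (-v) - (y + t' • v) = (x - y) - (s' + t') • v := by module
    rw [e1] at h
    rw [neg_neg, e2]
    have hpos : 0 < s + t := by
      refine lt_of_le_of_ne hst fun h0 => h ?_
      rw [← h0, zero_smul, add_zero]
    push Not at h
    have h5 : (s + t + (s' + t')) • (x - y)
        = (s' + t') • ((x - y) + (s + t) • v) + (s + t) • ((x - y) - (s' + t') • v) := by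
      module
    have h6 := norm_add_le ((s' + t') • ((x - y) + (s + t) • v))
      ((s + t) • ((x - y) - (s' + t') • v))
    rw [← h5, norm_smul, norm_smul, norm_smul, Real.norm_of_nonneg hst, Real.norm_of_nonneg hst',
      Real.norm_of_nonneg (by positivity)] at h6
    nlinarith
  -- Trivial kernel means dimension one: unit vectors agree up to sign, and `‖x - y‖ < 2`, so the
  -- modulus is taken at `0` or over the empty set.
  · push Not at hker
    have hinj : ∀ z, ‖x + y‖ • z = f z • (x + y) := by
      intro z
      by_contra hne
      refine hker _ (sub_ne_zero.2 hne) ?_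
      rw [map_sub, map_smul, map_smul, hfxy', smul_eq_mul, smul_eq_mul, mul_comm, sub_self]
    have habs : ∀ z, |f z| = ‖z‖ := by
      intro z
      have := congrArg norm (hinj z)
      rw [norm_smul, norm_smul, norm_norm, mul_comm, Real.norm_eq_abs] at this
      exact (mul_right_cancel₀ (norm_ne_zero_iff.2 h0) this).symm
    by_cases hex : ∃ x' y' : E, ‖x'‖ = 1 ∧ ‖y'‖ = 1 ∧ ‖x' - y'‖ = ‖x - y‖
    · obtain ⟨x', y', hx', hy', hxy'⟩ := hex
      have hpos : 0 < f x + f y := by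
        rw [← map_add, hfxy']
        exact norm_pos_iff.2 h0
      rw [← habs, map_sub] at hxy'
      rw [← habs] at hx' hy' hx hy
      have hd : ‖x - y‖ < 2 := by
        rw [← habs, map_sub, abs_lt]
        rw [abs_le] at hx hy
        constructor <;> linarith
      have hz : ‖x - y‖ = 0 := by
        rw [← hxy'] at hd ⊢
        rcases eq_or_eq_neg_of_abs_eq hx' with h1 | h1 <;>
        rcases eq_or_eq_neg_of_abs_eq hy' with h2 | h2 <;>
        rw [h1, h2] at hd ⊢ <;>
        first | (exfalso; norm_num at hd; done) | norm_num
      rw [hz, convexityModulus_zero]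
      rw [habs] at hx hy
      linarith [norm_add_le x y]
    · have : {t : ℝ | ∃ x' y' : E, ‖x'‖ = 1 ∧ ‖y'‖ = 1 ∧ ‖x' - y'‖ = ‖x - y‖ ∧
          t = 1 - ‖x' + y'‖ / 2} = ∅ := by
        ext t
        simp only [Set.mem_ofPred_eq, Set.mem_empty_iff_false, iff_false]
        rintro ⟨x', y', hx', hy', hxy, -⟩
        exact hex ⟨x', y', hx', hy', hxy⟩
      rw [convexityModulus, this, Real.sInf_empty]
      linarith [norm_add_le x y]

/-- The modulus of convexity in balls of radius at most `1`. -/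
theorem convexityModulus_le_sub {x y : E} {R : ℝ} (hR : R ≤ 1) (hx : ‖x‖ ≤ R) (hy : ‖y‖ ≤ R) :
    convexityModulus E ‖x - y‖ ≤ R - ‖x + y‖ / 2 := by
  by_cases h : x = y
  · subst h
    rw [sub_self, norm_zero, convexityModulus_zero]
    linarith [norm_add_le x x]
  obtain ⟨z, hz, hs⟩ := exists_translate_norm_add_eq h (show 0 ≤ 1 - R by linarith)
  have := convexityModulus_le_of_norm_le_one (x := x + z) (y := y + z)
    (by linarith [norm_add_le x z]) (by linarith [norm_add_le y z])
  rw [hs, add_sub_add_right_eq_sub] at this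
  linarith

end Convexity

/-! ### Asymptotic centres and `Δ`-compactness. -/

section DeltaConvergence

variable {κ Z : Type*} [NormedAddCommGroup Z]

/-- `Δ`-convergence along a filter. -/
def DeltaAlong (l : Filter κ) (u : κ → Z) (x : Z) : Prop :=
  ∀ y : Z, ∀ ε : ℝ, 0 < ε → ∀ᶠ k in l, ‖u k - x‖ ≤ ‖u k - y‖ + ε

theorem deltaAlong_atTop {u : ℕ → Z} {x : Z} : DeltaAlong atTop u x ↔ DeltaTendsto u x :=
  Iff.rfl

namespace DeltaAlong

variable {l l' : Filter κ} {u v : κ → Z} {a b : Z}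

theorem mono (h : DeltaAlong l u a) (hl : l' ≤ l) : DeltaAlong l' u a :=
  fun y ε hε => hl (h y ε hε)

theorem comp {κ' : Type*} {m : Filter κ'} {x : κ' → κ} (h : DeltaAlong l u a)
    (hx : Tendsto x m l) : DeltaAlong m (fun k => u (x k)) a :=
  fun y ε hε => hx.eventually (h y ε hε)

theorem of_approx
    (huv : ∀ ε : ℝ, 0 < ε → ∃ u' : κ → Z, DeltaAlong l u' a ∧ ∀ᶠ k in l, ‖u' k - v k‖ ≤ ε) :
    DeltaAlong l v a := by
  intro y ε hε
  obtain ⟨u', hu', huv⟩ := huv (ε / 3) (by positivity)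
  filter_upwards [huv, hu' y (ε / 3) (by positivity)] with k h1 h2
  have h3 := norm_add_le (u' k - y) (v k - u' k)
  have h4 := norm_add_le (v k - y) (u' k - v k)
  have h5 := norm_sub_le (u' k - a) (u' k - v k)
  have e1 : v k - y + (u' k - v k) = u' k - y := by abel
  have e2 : u' k - a - (u' k - v k) = v k - a := by abel
  rw [e1] at h4
  rw [e2] at h5
  linarith

theorem const_add (h : DeltaAlong l u a) (c : Z) : DeltaAlong l (fun k => u k + c) (a + c) := by
  intro y ε hε
  filter_upwards [h (y - c) ε hε] with k hk
  rw [add_sub_add_right_eq_sub]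
  convert hk using 3
  abel

theorem norm_le [l.NeBot] {C : ℝ} (h : DeltaAlong l u a) (hu : ∀ᶠ k in l, ‖u k‖ ≤ C) :
    ‖a‖ ≤ 2 * C := by
  refine le_of_forall_pos_le_add fun ε hε => ?_
  obtain ⟨k, h1, h2⟩ := ((h 0 ε hε).and hu).exists
  have h3 := norm_sub_le (u k) (u k - a)
  rw [sub_sub_cancel] at h3
  rw [sub_zero] at h1
  linarith

/-- If two limits differed, uniform convexity would make their midpoint closer to `u k` by a fixed
amount. -/
theorem unique [NormedSpace ℝ Z] [UniformConvexSpace Z] [l.NeBot] {C : ℝ}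
    (hu : ∀ᶠ k in l, ‖u k‖ ≤ C) (ha : DeltaAlong l u a) (hb : DeltaAlong l u b) : a = b := by
  by_contra hab
  obtain ⟨η, hη, h⟩ := exists_forall_norm_half_add_le (E := Z) (C + ‖a‖)
    (norm_sub_pos_iff.2 hab)
  obtain ⟨k, h1, h2, h3⟩ := (hu.and ((hb a η hη).and
    (ha ((1 / 2 : ℝ) • (a + b)) (η / 2) (by positivity)))).exists
  have h4 := h ‖u k - a‖ (by linarith [norm_sub_le (u k) a]) (u k - a) (u k - b) (by linarith) h2
    (by rw [sub_sub_sub_cancel_left, norm_sub_rev])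
  have e : u k - a + (u k - b) = (2 : ℝ) • (u k - (1 / 2 : ℝ) • (a + b)) := by module
  rw [e, norm_smul, Real.norm_ofNat] at h4
  linarith

end DeltaAlong

/-- Bounded sequences in complete uniformly convex spaces have `Δ`-convergent subsequences. -/
theorem exists_le_deltaAlong [NormedSpace ℝ Z] [UniformConvexSpace Z] [CompleteSpace Z]
    (l : Filter κ) [l.NeBot] [l.IsCountablyGenerated] {u : κ → Z} {C : ℝ} (hu : ∀ k, ‖u k‖ ≤ C) :
    ∃ l' ≤ l, l'.NeBot ∧ l'.IsCountablyGenerated ∧ ∃ a, DeltaAlong l' u a := by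
  -- `S l` collects the radii of balls that eventually contain `u` along some refinement of `l`.
  -- Successive refinements nearly attain its infimum.
  set S : Filter κ → Set ℝ := fun l => {c | ∃ l' ≤ l, l'.NeBot ∧ l'.IsCountablyGenerated ∧
    ∃ x, ∀ᶠ k in l', ‖u k - x‖ ≤ c} with hS
  have hSbdd : ∀ l, BddBelow (S l) := by
    intro l
    refine ⟨0, ?_⟩
    rintro c ⟨l', -, hne, -, x, hx⟩
    obtain ⟨k, hk⟩ := hx.exists
    exact (norm_nonneg _).trans hk
  have hSne : ∀ l : Filter κ, l.NeBot → l.IsCountablyGenerated → C ∈ S l := fun l h1 h2 =>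
    ⟨l, le_rfl, h1, h2, 0, Eventually.of_forall fun k => by simpa using hu k⟩
  have hSmono : ∀ l l' : Filter κ, l'.NeBot → l'.IsCountablyGenerated → l' ≤ l →
      sInf (S l) ≤ sInf (S l') := by
    intro l l' h1 h2 hl
    refine csInf_le_csInf (hSbdd l) ⟨C, hSne l' h1 h2⟩ ?_
    rintro c ⟨l'', h, h'⟩
    exact ⟨l'', h.trans hl, h'⟩
  have hstep : ∀ (L : {l : Filter κ // l.NeBot ∧ l.IsCountablyGenerated}) (n : ℕ),
      ∃ (L' : {l : Filter κ // l.NeBot ∧ l.IsCountablyGenerated}) (x : Z), L'.1 ≤ L.1 ∧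
        ∀ᶠ k in L'.1, ‖u k - x‖ ≤ sInf (S L.1) + 1 / ((n : ℝ) + 1) := by
    rintro ⟨L, h1, h2⟩ n
    obtain ⟨c, ⟨l', hl', hne, hcg, x, hx⟩, hc⟩ := exists_lt_of_csInf_lt ⟨C, hSne L h1 h2⟩
      (lt_add_of_pos_right (sInf (S L)) (Nat.one_div_pos_of_nat (α := ℝ) (n := n)))
    exact ⟨⟨l', hne, hcg⟩, x, hl', hx.mono fun k hk => hk.trans hc.le⟩
  choose next pt hnext hpt using hstep
  let L : ℕ → {l : Filter κ // l.NeBot ∧ l.IsCountablyGenerated} :=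
    fun n => Nat.rec ⟨l, ‹_›, ‹_›⟩ (fun n L => next L n) n
  have hanti : Antitone fun n => (L n).1 := antitone_nat_of_succ_le fun n => hnext (L n) n
  -- The infimum filter replaces a diagonal subsequence.
  set M : Filter κ := ⨅ n, (L n).1 with hM
  have hMle : ∀ n, M ≤ (L n).1 := fun n => iInf_le _ n
  have hMne : M.NeBot :=
    iInf_neBot_of_directed' (hanti.directed_ge) (fun n => (L n).2.1)
  have hMcg : M.IsCountablyGenerated := by
    have : ∀ n, (L n).1.IsCountablyGenerated := fun n => (L n).2.2
    exact Filter.iInf.isCountablyGenerated _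
  set m := sInf (S M) with hm
  have hmC : m ≤ C := csInf_le (hSbdd M) (hSne M hMne hMcg)
  -- Otherwise restricting `M` to the exceptional indices would give a radius below `m`. This is
  -- what makes the limit of the centres a `Δ`-limit.
  have hlow : ∀ (y : Z) (ε : ℝ), 0 < ε → ∀ᶠ k in M, m - ε ≤ ‖u k - y‖ := by
    intro y ε hε
    by_contra hcon
    rw [not_eventually] at hcon
    have hne : (M ⊓ 𝓟 {k | ¬ m - ε ≤ ‖u k - y‖}).NeBot := frequently_mem_iff_neBot.1 hcon
    have : m ≤ m - ε := by
      refine csInf_le (hSbdd M) ⟨_, inf_le_left, hne, inferInstance, y, ?_⟩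
      filter_upwards [mem_inf_of_right (mem_principal_self _)] with k hk
      exact (not_le.1 hk).le
    linarith
  have hup : ∀ n, ∀ᶠ k in M, ‖u k - pt (L n) n‖ ≤ m + 1 / ((n : ℝ) + 1) := by
    intro n
    filter_upwards [hMle (n + 1) (hpt (L n) n)] with k hk
    linarith [hSmono (L n).1 M hMne hMcg (hMle n)]
  have hcauchy : CauchySeq fun n => pt (L n) n := by
    rw [Metric.cauchySeq_iff]
    intro ε hε
    obtain ⟨η, hη, h⟩ := exists_forall_norm_half_add_le (E := Z) C hε
    obtain ⟨N, hN⟩ := exists_nat_one_div_lt hη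
    refine ⟨N, fun i hi j hj => ?_⟩
    by_contra hlt
    rw [not_lt, dist_eq_norm] at hlt
    obtain ⟨k, h1, h2, h3⟩ := ((hup i).and ((hup j).and
      (hlow ((1 / 2 : ℝ) • (pt (L i) i + pt (L j) j)) (η / 2) (by positivity)))).exists
    have hi' := Nat.one_div_le_one_div (α := ℝ) hi
    have hj' := Nat.one_div_le_one_div (α := ℝ) hj
    have h4 := h m hmC (u k - pt (L i) i) (u k - pt (L j) j) (by linarith) (by linarith)
      (by rwa [sub_sub_sub_cancel_left, norm_sub_rev])
    have e : u k - pt (L i) i + (u k - pt (L j) j)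
      = (2 : ℝ) • (u k - (1 / 2 : ℝ) • (pt (L i) i + pt (L j) j)) := by module
    rw [e, norm_smul, Real.norm_ofNat] at h4
    linarith
  obtain ⟨a, ha⟩ := cauchySeq_tendsto_of_complete hcauchy
  refine ⟨M, hMle 0, hMne, hMcg, a, fun y ε hε => ?_⟩
  have h1 : ∀ᶠ n in atTop, ‖pt (L n) n - a‖ < ε / 3 := by
    simpa [dist_eq_norm] using (Metric.tendsto_nhds.1 ha) (ε / 3) (by positivity)
  have h2 : ∀ᶠ n : ℕ in atTop, 1 / ((n : ℝ) + 1) < ε / 3 :=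
    tendsto_one_div_add_atTop_nhds_zero_nat.eventually_lt_const (by positivity)
  obtain ⟨n, hn1, hn2⟩ := (h1.and h2).exists
  filter_upwards [hup n, hlow y (ε / 3) (by positivity)] with k hk1 hk2
  have := norm_add_le (u k - pt (L n) n) (pt (L n) n - a)
  rw [sub_add_sub_cancel] at this
  linarith

end DeltaConvergence

/-! ### Consequences of the dislocation axioms. -/

section Dislocations

variable {𝕜 Z : Type*} [RCLike 𝕜] [NormedAddCommGroup Z] [NormedSpace 𝕜 Z]

theorem LinearIsometryEquiv.inv_mul_apply (g h : Z ≃ₗᵢ[𝕜] Z) (z : Z) :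
    (g⁻¹ * h) z = g⁻¹ (h z) := rfl

theorem LinearIsometryEquiv.inv_apply_apply (g : Z ≃ₗᵢ[𝕜] Z) (z : Z) : g⁻¹ (g z) = z :=
  g.symm_apply_apply z

theorem LinearIsometryEquiv.apply_inv_apply (g : Z ≃ₗᵢ[𝕜] Z) (z : Z) : g (g⁻¹ z) = z :=
  g.apply_symm_apply z

theorem LinearIsometryEquiv.norm_inv_apply_sub (g : Z ≃ₗᵢ[𝕜] Z) (x y : Z) :
    ‖g⁻¹ x - y‖ = ‖x - g y‖ := by
  rw [← g.norm_map, map_sub, g.apply_inv_apply]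

theorem DeltaTendsto.comp {u : ℕ → Z} {a : Z} (h : DeltaTendsto u a) {ψ : ℕ → ℕ}
    (hψ : Tendsto ψ atTop atTop) : DeltaTendsto (fun k => u (ψ k)) a :=
  DeltaAlong.comp (deltaAlong_atTop.2 h) hψ

theorem DDeltaNull.deltaTendsto {D : Set (Z ≃ₗᵢ[𝕜] Z)} {u : ℕ → Z} (h : DDeltaNull D u)
    {g : ℕ → (Z ≃ₗᵢ[𝕜] Z)} (hg : ∀ k, g k ∈ D) :
    DeltaTendsto (fun k => (g k)⁻¹ (u k)) 0 := h g hg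

namespace IsDislocationGroup

variable {D₀ : Subgroup (Z ≃ₗᵢ[𝕜] Z)} (hD₀ : IsDislocationGroup D₀)
include hD₀

/-- If the inverses were not weakly null, a subsequence of `h` would converge strongly, necessarily
to `0`; isometries preserve norms, so the space would be trivial. -/
theorem weakOpNull_inv {h : ℕ → (Z ≃ₗᵢ[𝕜] Z)} (hh : ∀ k, h k ∈ D₀) (hnull : WeakOpNull h) :
    WeakOpNull fun k => (h k)⁻¹ := by
  by_contra hcon
  obtain ⟨φ, hφ, hl, -⟩ := hD₀.exists_strong_limit _ (fun k => D₀.inv_mem (hh k)) hcon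
  refine hcon fun z f => ?_
  obtain ⟨l, hl⟩ := hl z
  have h1 : l = 0 := by
    by_contra hl0
    obtain ⟨f, hf, hfl⟩ := exists_dual_vector 𝕜 l (norm_ne_zero_iff.2 hl0)
    have h2 : Tendsto (fun j => f (((h (φ j))⁻¹)⁻¹ z)) atTop (𝓝 (f l)) :=
      (f.continuous.tendsto l).comp hl
    have h3 := (hnull z f).comp hφ.tendsto_atTop
    simp only [inv_inv] at h2
    have h4 := tendsto_nhds_unique h2 h3
    rw [hfl, map_zero] at h4
    simp [hl0] at h4
  have h5 : z = 0 := by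
    have h2 := hl.norm
    simp only [LinearIsometryEquiv.norm_map] at h2
    have h3 := tendsto_nhds_unique h2 tendsto_const_nhds
    rw [h1, norm_zero] at h3
    exact norm_eq_zero.1 h3.symm
  simp [h5]

theorem deltaTendsto_add_sum {u : ℕ → Z} (hu : DeltaTendsto u 0) {h : ℕ → ℕ → (Z ≃ₗᵢ[𝕜] Z)}
    (hh : ∀ n k, h n k ∈ D₀) {c : ℕ → Z} (s : Finset ℕ)
    (hs : ∀ n ∈ s, c n ≠ 0 → WeakOpNull (h n)) :
    DeltaTendsto (fun k => u k + ∑ n ∈ s, h n k (c n)) 0 := by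
  induction s using Finset.induction_on with
  | empty => simpa using hu
  | insert n s hn ih =>
    have ih' := ih fun m hm => hs m (Finset.mem_insert_of_mem hm)
    by_cases hc : c n = 0
    · simpa [Finset.sum_insert hn, hc] using ih'
    · have := hD₀.deltaTendsto_add _ (c n) (h n) ih' (hh n) (hs n (Finset.mem_insert_self _ _) hc)
      simpa only [Finset.sum_insert hn, add_assoc, add_comm (h n _ (c n))] using this

/-- Adding concentrations along gauges which are transversal to `g` does not affect the profile
of `r` along `g`. -/
theorem deltaTendsto_inv_add_sum {r : ℕ → Z} {g : ℕ → (Z ≃ₗᵢ[𝕜] Z)} (hg : ∀ k, g k ∈ D₀)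
    (hr : DeltaTendsto (fun k => (g k)⁻¹ (r k)) 0) {h : ℕ → ℕ → (Z ≃ₗᵢ[𝕜] Z)}
    (hh : ∀ n k, h n k ∈ D₀) {c : ℕ → Z} (s : Finset ℕ)
    (hs : ∀ n ∈ s, c n ≠ 0 → WeakOpNull fun k => (g k)⁻¹ * h n k) :
    DeltaTendsto (fun k => (g k)⁻¹ (r k + ∑ n ∈ s, h n k (c n))) 0 := by
  have := hD₀.deltaTendsto_add_sum hr (h := fun n k => (g k)⁻¹ * h n k)
    (fun n k => D₀.mul_mem (D₀.inv_mem (hg k)) (hh n k)) s hs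
  simpa only [map_add, map_sum, LinearIsometryEquiv.inv_mul_apply] using this

/-- A sequence without profiles along transversal gauges asymptotically does not gain norm
when the concentrations along these gauges are removed. -/
theorem eventually_norm_le_norm_add_sum {r : ℕ → Z} {g : ℕ → ℕ → (Z ≃ₗᵢ[𝕜] Z)}
    (hg : ∀ n k, g n k ∈ D₀) {c : ℕ → Z} (s : Finset ℕ)
    (hr : ∀ n ∈ s, c n ≠ 0 → DeltaTendsto (fun k => (g n k)⁻¹ (r k)) 0)
    (hdec : ∀ m n, c m ≠ 0 → c n ≠ 0 → m ≠ n → WeakOpNull fun k => (g n k)⁻¹ * g m k)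
    {ε : ℝ} (hε : 0 < ε) :
    ∀ᶠ k in atTop, ‖r k‖ ≤ ‖r k + ∑ n ∈ s, g n k (c n)‖ + ε := by
  induction s using Finset.induction_on generalizing ε with
  | empty => exact Eventually.of_forall fun k => by simpa using hε.le
  | insert n s hn ih =>
    have ih' := ih (fun m hm => hr m (Finset.mem_insert_of_mem hm)) (half_pos hε)
    by_cases hc : c n = 0
    · filter_upwards [ih'] with k hk
      rw [Finset.sum_insert hn, hc, map_zero, zero_add]
      linarith
    · have h1 := hD₀.deltaTendsto_inv_add_sum (hg n) (hr n (Finset.mem_insert_self _ _) hc) hg s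
        (c := c) fun m hm hcm => hdec m n hcm hc (by rintro rfl; exact hn hm)
      -- Testing the `Δ`-limit `0` against `-(c n)` shows that adding `g n k (c n)` costs no norm
      -- asymptotically.
      filter_upwards [ih', h1 (-(c n)) (ε / 2) (half_pos hε)] with k hk1 hk2
      rw [LinearIsometryEquiv.norm_inv_apply_sub, LinearIsometryEquiv.norm_inv_apply_sub,
        map_zero, sub_zero, map_neg, sub_neg_eq_add, add_assoc, add_comm (∑ _ ∈ _, _)] at hk2
      rw [Finset.sum_insert hn]
      linarith

/-- A sequence with zero profile along `h` and nonzero profile along `g`: the gauges `g` and `h`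
are transversal. -/
theorem weakOpNull_inv_mul [NormedSpace ℝ Z] [UniformConvexSpace Z] {v : ℕ → Z} {C : ℝ}
    (hv : ∀ k, ‖v k‖ ≤ C) {g h : ℕ → (Z ≃ₗᵢ[𝕜] Z)} (hg : ∀ k, g k ∈ D₀) (hh : ∀ k, h k ∈ D₀)
    {a : Z} (ha : a ≠ 0) (hva : DeltaTendsto (fun k => (g k)⁻¹ (v k)) a)
    (hv0 : DeltaTendsto (fun k => (h k)⁻¹ (v k)) 0) :
    WeakOpNull fun k => (h k)⁻¹ * g k := by
  -- Otherwise `h⁻¹ g` converges strongly along a subsequence. Testing the zero profile along `h` at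
  -- the limit of `h⁻¹ g y` makes `0` a profile along `g` too, against uniqueness.
  by_contra hcon
  obtain ⟨φ, hφ, -, hl⟩ := hD₀.exists_strong_limit _
    (fun k => D₀.mul_mem (D₀.inv_mem (hh k)) (hg k)) hcon
  have h1 : DeltaAlong atTop (fun j => (g (φ j))⁻¹ (v (φ j))) a := hva.comp hφ.tendsto_atTop
  refine ha (h1.unique (C := C) (b := 0)
    (Eventually.of_forall fun j => by simpa using hv (φ j)) ?_)
  intro y ε hε
  obtain ⟨l, hl⟩ := hl y
  have h2 := (hv0.comp hφ.tendsto_atTop) l (ε / 2) (half_pos hε)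
  have h3 := (Metric.tendsto_nhds.1 hl) (ε / 2) (half_pos hε)
  filter_upwards [h2, h3] with j hj1 hj2
  rw [dist_eq_norm, LinearIsometryEquiv.inv_mul_apply, LinearIsometryEquiv.norm_inv_apply_sub]
    at hj2
  rw [LinearIsometryEquiv.norm_inv_apply_sub, LinearIsometryEquiv.norm_inv_apply_sub, map_zero]
    at hj1 ⊢
  have h4 := norm_sub_le_norm_sub_add_norm_sub (v (φ j)) (g (φ j) y) (h (φ j) l)
  linarith

end IsDislocationGroup

end Dislocations

/-! ### Greedy extraction of profiles along refining filters. -/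

section Greedy

variable {𝕜 Z : Type*} [RCLike 𝕜] [NormedAddCommGroup Z] [NormedSpace 𝕜 Z]
  [NormedSpace ℝ Z] [UniformConvexSpace Z] [CompleteSpace Z]

/-- Every bounded sequence has, along some filter, a profile which is maximal up to a factor. -/
theorem exists_almost_maximal_profile {D : Set (Z ≃ₗᵢ[𝕜] Z)} (hD : 1 ∈ D) {l : Filter ℕ}
    (hl : l ≤ atTop) (hne : l.NeBot) (hcg : l.IsCountablyGenerated) {r : ℕ → Z} {C : ℝ}
    (hr : ∀ k, ‖r k‖ ≤ C) :
    ∃ l' ≤ l, l'.NeBot ∧ l'.IsCountablyGenerated ∧ ∃ (g : ℕ → (Z ≃ₗᵢ[𝕜] Z)) (w : Z),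
      (∀ k, g k ∈ D) ∧ DeltaAlong l' (fun k => (g k)⁻¹ (r k)) w ∧
      ∀ (x : ℕ → ℕ) (h : ℕ → (Z ≃ₗᵢ[𝕜] Z)) (a : Z), Tendsto x atTop l → (∀ k, h k ∈ D) →
        DeltaTendsto (fun k => (h k)⁻¹ (r (x k))) a → ‖a‖ ≤ 2 * ‖w‖ := by
  set S : Set ℝ := {t | ∃ (x : ℕ → ℕ) (h : ℕ → (Z ≃ₗᵢ[𝕜] Z)) (a : Z), Tendsto x atTop l ∧
    (∀ k, h k ∈ D) ∧ DeltaTendsto (fun k => (h k)⁻¹ (r (x k))) a ∧ ‖a‖ = t} with hS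
  have hSbdd : BddAbove S := by
    refine ⟨2 * C, ?_⟩
    rintro t ⟨x, h, a, -, -, ha, rfl⟩
    exact DeltaAlong.norm_le (deltaAlong_atTop.2 ha)
      (Eventually.of_forall fun k => by simpa using hr (x k))
  have hSne : S.Nonempty := by
    obtain ⟨l', hl', hne', hcg', a, ha⟩ := exists_le_deltaAlong l hr
    obtain ⟨x, hx⟩ := exists_seq_tendsto l'
    exact ⟨‖a‖, x, fun _ => 1, a, hx.mono_right hl', fun _ => hD, ha.comp hx, rfl⟩
  obtain ⟨t, ⟨x, h, a, hx, hh, ha, rfl⟩, ht⟩ : ∃ t ∈ S, sSup S ≤ 2 * t := by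
    by_cases hpos : 0 < sSup S
    · obtain ⟨t, ht, ht'⟩ := exists_lt_of_lt_csSup hSne (half_lt_self hpos)
      exact ⟨t, ht, by linarith⟩
    · obtain ⟨t, ht⟩ := hSne
      have : 0 ≤ t := by
        obtain ⟨-, -, a, -, -, -, rfl⟩ := ht
        exact norm_nonneg a
      exact ⟨t, ht, by linarith⟩
  -- The gauges are indexed by positions in the sequence `x`. Making `x` injective allows them to be
  -- reindexed by `k`, with the identity off the range.
  obtain ⟨ψ, hψ, hxψ⟩ := strictMono_subseq_of_tendsto_atTop (hx.mono_right hl)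
  have hinj : Function.Injective fun j => x (ψ j) := hxψ.injective
  refine ⟨map (fun j => x (ψ j)) atTop, hx.comp hψ.tendsto_atTop, inferInstance, inferInstance,
    Function.extend (fun j => x (ψ j)) (fun j => h (ψ j)) (fun _ => 1), a, ?_, ?_, ?_⟩
  · intro k
    by_cases hk : ∃ j, x (ψ j) = k
    · obtain ⟨j, rfl⟩ := hk
      rw [hinj.extend_apply (fun j => h (ψ j)) _ j]
      exact hh _
    · rw [Function.extend_apply' _ _ _ hk]
      exact hD
  · intro y ε hε
    rw [eventually_map]
    filter_upwards [ha.comp hψ.tendsto_atTop y ε hε] with j hj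
    rwa [hinj.extend_apply (fun j => h (ψ j)) _ j]
  · exact fun x' h' a' hx' hh' ha' =>
      (le_csSup hSbdd ⟨x', h', a', hx', hh', ha', rfl⟩).trans ht

/-- Iterated extraction of almost maximal profiles. -/
theorem exists_greedy_profiles {D : Set (Z ≃ₗᵢ[𝕜] Z)} (hD : 1 ∈ D) {u : ℕ → Z} {C : ℝ}
    (hu : ∀ k, ‖u k‖ ≤ C) :
    ∃ (l : Filter ℕ) (g : ℕ → ℕ → (Z ≃ₗᵢ[𝕜] Z)) (w : ℕ → Z), l ≤ atTop ∧ l.NeBot ∧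
      l.IsCountablyGenerated ∧ (∀ n k, g n k ∈ D) ∧ (∀ k, g 0 k = 1) ∧
      (∀ n, DeltaAlong l (fun k => (g n k)⁻¹ (u k - ∑ j ∈ Finset.range n, g j k (w j))) (w n)) ∧
      ∀ n, n ≠ 0 → ∀ (x : ℕ → ℕ) (h : ℕ → (Z ≃ₗᵢ[𝕜] Z)) (a : Z), Tendsto x atTop l →
        (∀ k, h k ∈ D) → DeltaTendsto
          (fun k => (h k)⁻¹ (u (x k) - ∑ j ∈ Finset.range n, g j (x k) (w j))) a →
        ‖a‖ ≤ 2 * ‖w n‖ := by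
  let State := {p : Filter ℕ × (ℕ → Z) //
    p.1 ≤ atTop ∧ p.1.NeBot ∧ p.1.IsCountablyGenerated ∧ ∃ C, ∀ k, ‖p.2 k‖ ≤ C}
  -- Only the identity is admitted at stage `0`; this is why maximality is claimed only for `n ≠ 0`.
  let E : ℕ → Set (Z ≃ₗᵢ[𝕜] Z) := fun n => if n = 0 then {1} else D
  have hE : ∀ n, 1 ∈ E n := by
    intro n
    by_cases hn : n = 0 <;> simp [E, hn, hD]
  have hED : ∀ n, E n ⊆ D := by
    intro n
    by_cases hn : n = 0 <;> simp [E, hn, hD]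
  have hstep : ∀ (p : State) (n : ℕ), ∃ (p' : State) (g : ℕ → (Z ≃ₗᵢ[𝕜] Z)) (w : Z),
      p'.1.1 ≤ p.1.1 ∧ (∀ k, p'.1.2 k = p.1.2 k - g k w) ∧ (∀ k, g k ∈ E n) ∧
      DeltaAlong p'.1.1 (fun k => (g k)⁻¹ (p.1.2 k)) w ∧
      ∀ (x : ℕ → ℕ) (h : ℕ → (Z ≃ₗᵢ[𝕜] Z)) (a : Z), Tendsto x atTop p.1.1 →
        (∀ k, h k ∈ E n) → DeltaTendsto (fun k => (h k)⁻¹ (p.1.2 (x k))) a → ‖a‖ ≤ 2 * ‖w‖ := by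
    rintro ⟨⟨l, r⟩, h1, h2, h3, C, hC⟩ n
    obtain ⟨l', hl', hne, hcg, g, w, hg, hw, hmax⟩ :=
      exists_almost_maximal_profile (hE n) h1 h2 h3 hC
    refine ⟨⟨⟨l', fun k => r k - g k w⟩, hl'.trans h1, hne, hcg, C + ‖w‖, fun k => ?_⟩, g, w, hl',
      fun k => rfl, hg, hw, hmax⟩
    exact (norm_sub_le _ _).trans (by rw [LinearIsometryEquiv.norm_map]; gcongr; exact hC k)
  choose next gg ww hle hr hg hw hmax using hstep
  let p : ℕ → State := fun n => Nat.rec ⟨⟨atTop, u⟩, le_rfl, inferInstance, inferInstance, C, hu⟩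
    (fun n p => next p n) n
  have hanti : Antitone fun n => (p n).1.1 := antitone_nat_of_succ_le fun n => hle (p n) n
  have hres : ∀ n k, (p n).1.2 k = u k - ∑ j ∈ Finset.range n, gg (p j) j k (ww (p j) j) := by
    intro n k
    induction n with
    | zero => simp [p]
    | succ n ih =>
      rw [Finset.sum_range_succ, ← sub_sub, ← ih]
      exact hr (p n) n k
  have hMle : ∀ n, ⨅ n, (p n).1.1 ≤ (p n).1.1 := fun n => iInf_le _ n
  refine ⟨⨅ n, (p n).1.1, fun n => gg (p n) n, fun n => ww (p n) n, hMle 0, ?_, ?_,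
    fun n k => hED n (hg _ _ k), fun k => ?_, fun n => ?_, fun n hn x h a hx hh ha => ?_⟩
  · exact iInf_neBot_of_directed' hanti.directed_ge fun n => (p n).2.2.1
  · have : ∀ n, (p n).1.1.IsCountablyGenerated := fun n => (p n).2.2.2.1
    exact Filter.iInf.isCountablyGenerated _
  · simpa [E] using hg (p 0) 0 k
  · have := (hw (p n) n).mono (hMle (n + 1))
    simpa only [hres] using this
  · refine hmax (p n) n x h a (hx.mono_right (hMle n)) (by simpa [E, hn] using hh) ?_
    simpa only [hres] using ha

end Greedy

/-! ### Decoupling of greedy profiles and smallness of tails. -/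

section Greedy

variable {𝕜 Z : Type*} [RCLike 𝕜] [NormedAddCommGroup Z] [NormedSpace 𝕜 Z]

/-- Profiles `w n` with gauges `g n` of the sequence `v`, extracted one after the other, such that
all but the first one are maximal up to a factor `2`. -/
structure IsGreedyFamily (D : Set (Z ≃ₗᵢ[𝕜] Z)) (v : ℕ → Z) (g : ℕ → ℕ → (Z ≃ₗᵢ[𝕜] Z))
    (w : ℕ → Z) : Prop where
  mem : ∀ n k, g n k ∈ D
  first_eq_one : ∀ k, g 0 k = 1
  profile : ∀ n,
    DeltaTendsto (fun k => (g n k)⁻¹ (v k - ∑ j ∈ Finset.range n, g j k (w j))) (w n)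
  maximal : ∀ n, n ≠ 0 → ∀ (ψ : ℕ → ℕ) (h : ℕ → (Z ≃ₗᵢ[𝕜] Z)) (a : Z), Tendsto ψ atTop atTop →
    (∀ k, h k ∈ D) → DeltaTendsto
      (fun k => (h k)⁻¹ (v (ψ k) - ∑ j ∈ Finset.range n, g j (ψ k) (w j))) a →
    ‖a‖ ≤ 2 * ‖w n‖

theorem norm_sub_sum_le {v : ℕ → Z} {C : ℝ} (hv : ∀ k, ‖v k‖ ≤ C) (g : ℕ → ℕ → (Z ≃ₗᵢ[𝕜] Z))
    (w : ℕ → Z) (s : Finset ℕ) (k : ℕ) :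
    ‖v k - ∑ n ∈ s, g n k (w n)‖ ≤ C + ∑ n ∈ s, ‖w n‖ := by
  refine (norm_sub_le _ _).trans (add_le_add (hv k) ((norm_sum_le _ _).trans_eq ?_))
  exact Finset.sum_congr rfl fun n _ => LinearIsometryEquiv.norm_map _ _

namespace IsGreedyFamily

variable {D : Set (Z ≃ₗᵢ[𝕜] Z)} {D₀ : Subgroup (Z ≃ₗᵢ[𝕜] Z)} {v : ℕ → Z}
  {g : ℕ → ℕ → (Z ≃ₗᵢ[𝕜] Z)} {w : ℕ → Z} {C : ℝ}

theorem comp (h : IsGreedyFamily D v g w) {φ : ℕ → ℕ} (hφ : Tendsto φ atTop atTop) :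
    IsGreedyFamily D (fun k => v (φ k)) (fun n k => g n (φ k)) w where
  mem n k := h.mem n (φ k)
  first_eq_one k := h.first_eq_one (φ k)
  profile n := (h.profile n).comp hφ
  maximal n hn ψ h' a hψ hh ha := h.maximal n hn (fun k => φ (ψ k)) h' a (hφ.comp hψ) hh ha

theorem exists_comp [NormedSpace ℝ Z] [UniformConvexSpace Z] [CompleteSpace Z] (hD : 1 ∈ D)
    (hv : ∀ k, ‖v k‖ ≤ C) :
    ∃ φ : ℕ → ℕ, StrictMono φ ∧ ∃ g w, IsGreedyFamily D (fun k => v (φ k)) g w := by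
  obtain ⟨l, g, w, hl, hne, hcg, hg, h0, hw, hmax⟩ := exists_greedy_profiles hD hv
  obtain ⟨x, hx⟩ := exists_seq_tendsto l
  obtain ⟨ψ, hψ, hxψ⟩ := strictMono_subseq_of_tendsto_atTop (hx.mono_right hl)
  have hxl := hx.comp hψ.tendsto_atTop
  exact ⟨fun j => x (ψ j), hxψ, fun n k => g n (x (ψ k)), w, fun n k => hg _ _, fun k => h0 _,
    fun n => (hw n).comp hxl, fun n hn χ h a hχ hh ha =>
      hmax n hn (fun k => x (ψ (χ k))) h a (hxl.comp hχ) hh ha⟩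

variable (hG : IsGreedyFamily D v g w)
include hG

/-- By induction the residuals at stages `n` and `m` coincide, so maximality at stage `n` bounds `w
m` by `2 * ‖w n‖`. -/
theorem eq_zero_of_le {m n : ℕ} (hn : n ≠ 0) (hwn : w n = 0) (hnm : n ≤ m) : w m = 0 := by
  induction m using Nat.strong_induction_on with
  | _ m ih =>
    rcases hnm.eq_or_lt with rfl | hlt
    · exact hwn
    have h1 := hG.profile m
    have h2 : ∀ k, ∑ j ∈ Finset.range m, g j k (w j) = ∑ j ∈ Finset.range n, g j k (w j) := by
      intro k
      refine (Finset.sum_subset (Finset.range_mono hlt.le) fun j hj hj' => ?_).symm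
      rw [Finset.mem_range] at hj hj'
      rw [ih j hj (not_lt.1 hj'), map_zero]
    simp only [h2] at h1
    have := hG.maximal n hn id _ _ tendsto_id (hG.mem m) h1
    simpa [hwn] using this

variable (hD₀ : IsDislocationGroup D₀) (hD : D ⊆ (D₀ : Set (Z ≃ₗᵢ[𝕜] Z)))
  (hv : ∀ k, ‖v k‖ ≤ C) [NormedSpace ℝ Z] [UniformConvexSpace Z]
include hD₀ hD hv

/-- Subtracting `w m` leaves profile zero along `g m`. A later nonzero profile of such a residual
has a gauge transversal to `g m`, so its removal keeps the profile zero. -/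
theorem deltaTendsto_inv_residual {m n : ℕ} (hmn : m < n) :
    DeltaTendsto (fun k => (g m k)⁻¹ (v k - ∑ j ∈ Finset.range n, g j k (w j))) 0 := by
  induction n with
  | zero => simp at hmn
  | succ n ih =>
    rcases (Nat.lt_succ_iff.1 hmn).eq_or_lt with rfl | hlt
    · have h1 := (deltaAlong_atTop.2 (hG.profile m)).const_add (-(w m))
      rw [add_neg_cancel] at h1
      have e : ∀ k, (g m k)⁻¹ (v k - ∑ j ∈ Finset.range (m + 1), g j k (w j))
          = (g m k)⁻¹ (v k - ∑ j ∈ Finset.range m, g j k (w j)) + -w m := by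
        intro k
        rw [Finset.sum_range_succ, ← sub_sub, map_sub _ (v k - _),
          LinearIsometryEquiv.inv_apply_apply, ← sub_eq_add_neg]
      simpa only [e] using deltaAlong_atTop.1 h1
    · have ih := ih hlt
      by_cases hwn : w n = 0
      · simpa only [Finset.sum_range_succ, hwn, map_zero, add_zero] using ih
      have hdec : WeakOpNull fun k => (g m k)⁻¹ * g n k :=
        hD₀.weakOpNull_inv_mul (norm_sub_sum_le hv g w (Finset.range n))
          (fun k => hD (hG.mem n k)) (fun k => hD (hG.mem m k)) hwn (hG.profile n) ih
      have := hD₀.deltaTendsto_inv_add_sum (fun k => hD (hG.mem m k)) ih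
        (fun n k => hD (hG.mem n k)) (c := fun n => -w n) {n}
        (by simpa using fun _ => hdec)
      simpa only [Finset.sum_singleton, map_neg, ← sub_eq_add_neg, sub_sub,
        ← Finset.sum_range_succ] using this

theorem weakOpNull_of_lt {m n : ℕ} (hmn : m < n) (hwn : w n ≠ 0) :
    WeakOpNull fun k => (g m k)⁻¹ * g n k :=
  hD₀.weakOpNull_inv_mul (norm_sub_sum_le hv g w (Finset.range n))
    (fun k => hD (hG.mem n k)) (fun k => hD (hG.mem m k)) hwn (hG.profile n)
    (hG.deltaTendsto_inv_residual hD₀ hD hv hmn)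

theorem weakOpNull_of_gt {m n : ℕ} (hmn : m < n) (hwn : w n ≠ 0) :
    WeakOpNull fun k => (g n k)⁻¹ * g m k := by
  have := hD₀.weakOpNull_inv
    (fun k => D₀.mul_mem (D₀.inv_mem (hD (hG.mem m k))) (hD (hG.mem n k)))
    (hG.weakOpNull_of_lt hD₀ hD hv hmn hwn)
  simpa only [mul_inv_rev, inv_inv] using this

theorem weakOpNull {m n : ℕ} (hmn : m ≠ n) (hm : m = 0 ∨ w m ≠ 0) (hn : n = 0 ∨ w n ≠ 0) :
    WeakOpNull fun k => (g n k)⁻¹ * g m k := by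
  rcases hmn.lt_or_gt with h | h
  · exact hG.weakOpNull_of_gt hD₀ hD hv h (hn.resolve_left (by omega))
  · exact hG.weakOpNull_of_lt hD₀ hD hv h (hm.resolve_left (by omega))

/-- Starting from an initial segment containing `s`, the superfluous terms are put back; all are
transversal to `g n`. -/
theorem deltaTendsto_inv_sub_sum (s : Finset ℕ) {n : ℕ} (hn : n ∈ s) (hwn : w n ≠ 0) :
    DeltaTendsto (fun k => (g n k)⁻¹ (v k - ∑ j ∈ s, g j k (w j))) 0 := by
  obtain ⟨M, hM⟩ := s.exists_nat_subset_range
  have h1 := hG.deltaTendsto_inv_residual hD₀ hD hv (Finset.mem_range.1 (hM hn))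
  have h2 := hD₀.deltaTendsto_inv_add_sum (fun k => hD (hG.mem n k)) h1
    (fun n k => hD (hG.mem n k)) (c := w) (Finset.range M \ s) fun m hm hwm =>
      hG.weakOpNull hD₀ hD hv (by rintro rfl; exact (Finset.mem_sdiff.1 hm).2 hn)
        (Or.inr hwm) (Or.inr hwn)
  have h3 : ∀ k, v k - ∑ j ∈ Finset.range M, g j k (w j) + ∑ j ∈ Finset.range M \ s, g j k (w j)
      = v k - ∑ j ∈ s, g j k (w j) := by
    intro k
    rw [← Finset.sum_sdiff hM]
    abel
  simpa only [h3] using h2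

end IsGreedyFamily

/-- Sums of transversal concentrations which are far out in the family are asymptotically small,
if these concentrations are the profiles of one bounded sequence. -/
theorem IsDislocationGroup.exists_forall_eventually_norm_sum_le [NormedSpace ℝ Z]
    [UniformConvexSpace Z] {D₀ : Subgroup (Z ≃ₗᵢ[𝕜] Z)} (hD₀ : IsDislocationGroup D₀)
    {v : ℕ → Z} {g : ℕ → ℕ → (Z ≃ₗᵢ[𝕜] Z)} {w : ℕ → Z} (hg : ∀ n k, g n k ∈ D₀)
    (hdec : ∀ m n, w m ≠ 0 → w n ≠ 0 → m ≠ n → WeakOpNull fun k => (g n k)⁻¹ * g m k)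
    (hres : ∀ (s : Finset ℕ) (n : ℕ), n ∈ s → w n ≠ 0 →
      DeltaTendsto (fun k => (g n k)⁻¹ (v k - ∑ j ∈ s, g j k (w j))) 0)
    {ρ : Finset ℕ → ℝ}
    (hρ : ∀ s, Tendsto (fun k => ‖v k - ∑ j ∈ s, g j k (w j)‖) atTop (𝓝 (ρ s)))
    {ε : ℝ} (hε : 0 < ε) :
    ∃ m, ∀ s : Finset ℕ, (∀ n ∈ s, m ≤ n) → ∀ᶠ k in atTop, ‖∑ n ∈ s, g n k (w n)‖ ≤ ε := by
  have hanti : ∀ s t : Finset ℕ, s ⊆ t → ρ t ≤ ρ s := by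
    intro s t hst
    refine le_of_forall_pos_le_add fun η hη => le_of_tendsto_of_tendsto (hρ t)
      ((hρ s).add_const η) ?_
    have := hD₀.eventually_norm_le_norm_add_sum hg (t \ s)
      (fun n hn => hres t n (Finset.mem_sdiff.1 hn).1) hdec hη
    filter_upwards [this] with k hk
    have e : v k - ∑ j ∈ t, g j k (w j) + ∑ j ∈ t \ s, g j k (w j)
        = v k - ∑ j ∈ s, g j k (w j) := by
      rw [← Finset.sum_sdiff hst]
      abel
    rwa [e] at hk
  have hnn : ∀ s, 0 ≤ ρ s := fun s => ge_of_tendsto' (hρ s) fun k => norm_nonneg _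
  have hbdd : BddBelow (Set.range ρ) := ⟨0, by rintro _ ⟨s, rfl⟩; exact hnn s⟩
  obtain ⟨η, hη, huc⟩ := exists_forall_norm_half_add_le (E := Z) (ρ ∅) hε
  obtain ⟨s₀, hs₀⟩ := exists_lt_of_ciInf_lt (lt_add_of_pos_right (⨅ s, ρ s) hη)
  obtain ⟨m, hm⟩ := s₀.exists_nat_subset_range
  refine ⟨m, fun s hs => ?_⟩
  have hdisj : Disjoint (Finset.range m) s := by
    rw [Finset.disjoint_left]
    intro n hn hn'
    exact absurd (hs n hn') (not_le.2 (Finset.mem_range.1 hn))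
  set t := Finset.range m ∪ s with ht
  have hinf := ciInf_le hbdd t
  have h1 := (hρ (Finset.range m)).eventually_le_const
    (lt_of_le_of_lt (hanti _ _ hm) hs₀)
  have h2 := (hρ t).eventually_le_const
    (lt_of_le_of_lt (hanti _ _ (hm.trans Finset.subset_union_left)) hs₀)
  have h3 := (hρ t).eventually_const_lt (lt_of_lt_of_le (sub_lt_self _ (half_pos hη)) hinf)
  -- Putting back half of the terms of `s` yields the midpoint of two residuals of norm at most `inf
  -- ρ + η`. Its norm exceeds `inf ρ - η`, so the residuals differ by less than `ε`.
  have h4 := hD₀.eventually_norm_le_norm_add_sum hg (c := fun n => (1 / 2 : 𝕜) • w n) s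
    (r := fun k => v k - ∑ j ∈ t, g j k (w j))
    (fun n hn hc => hres t n (Finset.mem_union_right _ hn) (right_ne_zero_of_smul hc))
    (fun m n hm hn => hdec m n (right_ne_zero_of_smul hm) (right_ne_zero_of_smul hn))
    (half_pos hη)
  filter_upwards [h1, h2, h3, h4] with k hk1 hk2 hk3 hk4
  by_contra hlt
  push Not at hlt
  have e1 : ∑ j ∈ t, g j k (w j)
      = ∑ j ∈ Finset.range m, g j k (w j) + ∑ j ∈ s, g j k (w j) := Finset.sum_union hdisj
  have hd : v k - ∑ j ∈ Finset.range m, g j k (w j) - (v k - ∑ j ∈ t, g j k (w j))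
      = ∑ j ∈ s, g j k (w j) := by
    rw [e1]
    abel
  have h5 := huc (⨅ s, ρ s) (ciInf_le hbdd ∅) _ _ hk1 hk2 (by rw [hd]; exact hlt.le)
  have e2 : v k - ∑ j ∈ t, g j k (w j) + ∑ n ∈ s, g n k ((1 / 2 : 𝕜) • w n)
      = (1 / 2 : 𝕜) • (v k - ∑ j ∈ Finset.range m, g j k (w j)
        + (v k - ∑ j ∈ t, g j k (w j))) := by
    simp only [map_smul, ← Finset.smul_sum]
    rw [e1]
    module
  rw [e2, norm_smul] at hk4
  have e3 : ‖(1 / 2 : 𝕜)‖ = 1 / 2 := by simp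
  rw [e3] at hk4
  linarith

end Greedy

/-! ### From asymptotic to uniform smallness of tails. -/

/-- A family of sequences whose tails have asymptotically small finite partial sums has uniformly
small tails after a change of finitely many terms of each sequence. -/
theorem exists_forall_norm_sum_max_le {Z : Type*} [NormedAddCommGroup Z] {f : ℕ → ℕ → Z}
    (hf : ∀ ε : ℝ, 0 < ε → ∃ m, ∀ s : Finset ℕ, (∀ n ∈ s, m ≤ n) →
      ∀ᶠ k in atTop, ‖∑ n ∈ s, f n k‖ ≤ ε) :
    ∃ K : ℕ → ℕ, ∀ ε : ℝ, 0 < ε → ∃ m, ∀ s : Finset ℕ, (∀ n ∈ s, m ≤ n) →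
      ∀ k, ‖∑ n ∈ s, f n (max k (K n))‖ ≤ ε := by
  choose b hb using fun j : ℕ => hf ((1 / 2 : ℝ) ^ j) (by positivity)
  -- `J n` is the level of `n`. Since `J → ∞`, each level is finite, so one `M j` serves all subsets
  -- of level `j + 1`; far tails are then dominated by a geometric series over the levels.
  obtain ⟨J, hJ, hJ'⟩ : ∃ J : ℕ → ℕ, (∀ n j, j < J n → b j ≤ n) ∧ ∀ j, ∃ B, ∀ n, B ≤ n → j < J n := by
    classical
    refine ⟨fun n => Nat.findGreatest (fun j => ∀ i < j, b i ≤ n) n, fun n j hj => ?_, fun j => ?_⟩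
    · exact Nat.findGreatest_spec (P := fun j => ∀ i < j, b i ≤ n) (Nat.zero_le n)
        (fun i hi => absurd hi (Nat.not_lt_zero i)) j hj
    · refine ⟨max (j + 1) ((Finset.range (j + 1)).sup b), fun n hn => ?_⟩
      refine Nat.lt_of_succ_le (Nat.le_findGreatest (le_of_max_le_left hn) fun i hi => ?_)
      exact (Finset.le_sup (Finset.mem_range.2 hi)).trans (le_of_max_le_right hn)
  have hM : ∀ j, ∃ M, ∀ s : Finset ℕ, (∀ n ∈ s, J n = j + 1) → ∀ k, M ≤ k →
      ‖∑ n ∈ s, f n k‖ ≤ (1 / 2 : ℝ) ^ j := by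
    intro j
    obtain ⟨B, hB⟩ := hJ' (j + 1)
    have : ∀ᶠ k in atTop, ∀ s ∈ (Finset.range B).powerset, (∀ n ∈ s, J n = j + 1) →
        ‖∑ n ∈ s, f n k‖ ≤ (1 / 2 : ℝ) ^ j := by
      rw [Filter.eventually_all_finset]
      intro s _
      by_cases hs : ∀ n ∈ s, J n = j + 1
      · filter_upwards [hb j s fun n hn => hJ n j (by rw [hs n hn]; exact j.lt_succ_self)]
          with k hk _ using hk
      · exact Eventually.of_forall fun k h => absurd h hs
    obtain ⟨M, hM⟩ := eventually_atTop.1 this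
    refine ⟨M, fun s hs k hk => hM k hk s ?_ hs⟩
    rw [Finset.mem_powerset]
    intro n hn
    rw [Finset.mem_range]
    by_contra hlt
    have := hB n (not_lt.1 hlt)
    rw [hs n hn] at this
    exact lt_irrefl _ this
  choose M hM using hM
  refine ⟨fun n => M (J n - 1), fun ε hε => ?_⟩
  have hsum : Summable fun j : ℕ => (1 / 2 : ℝ) ^ (j - 1) := by
    rw [← summable_nat_add_iff 1]
    simpa using summable_geometric_two
  obtain ⟨s₀, hs₀⟩ := summable_iff_vanishing_norm.1 hsum ε hε
  obtain ⟨m, hm⟩ := hJ' (s₀.sup id)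
  refine ⟨m, fun s hs k => ?_⟩
  rw [← Finset.sum_fiberwise_of_maps_to (g := J) (t := s.image J)
    (fun n hn => Finset.mem_image_of_mem J hn)]
  have hlarge : ∀ j ∈ s.image J, s₀.sup id < j := by
    intro j hj
    obtain ⟨n, hn, rfl⟩ := Finset.mem_image.1 hj
    exact hm n (hs n hn)
  calc _ ≤ ∑ j ∈ s.image J, (1 / 2 : ℝ) ^ (j - 1) := by
        refine (norm_sum_le _ _).trans (Finset.sum_le_sum fun j hj => ?_)
        have hj1 : j - 1 + 1 = j := Nat.succ_pred_eq_of_pos (Nat.zero_lt_of_lt (hlarge j hj))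
        rw [Finset.sum_congr rfl fun n hn =>
          show f n (max k (M (J n - 1))) = f n (max k (M (j - 1))) by
            rw [(Finset.mem_filter.1 hn).2]]
        refine hM (j - 1) _ (fun n hn => ?_) _ (le_max_right _ _)
        rw [hj1]
        exact (Finset.mem_filter.1 hn).2
    _ ≤ ε := by
        refine (le_abs_self _).trans (hs₀ _ ?_).le
        rw [Finset.disjoint_left]
        intro j hj hj'
        exact absurd (Finset.le_sup (f := id) hj') (not_le.2 (hlarge j hj))

/-! ### Existence of the decomposition. -/

section Existence

variable {𝕜 Z : Type*} [RCLike 𝕜] [NormedAddCommGroup Z] [NormedSpace 𝕜 Z]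

theorem WeakOpNull.congr' {g h : ℕ → (Z ≃ₗᵢ[𝕜] Z)} (hg : WeakOpNull g)
    (hgh : ∀ᶠ k in atTop, g k = h k) : WeakOpNull h := by
  intro z f
  refine (hg z f).congr' ?_
  filter_upwards [hgh] with k hk
  rw [hk]

theorem tendstoUniformly_sum_tsum [CompleteSpace Z] {f : ℕ → ℕ → Z}
    (hf : ∀ ε : ℝ, 0 < ε → ∃ m, ∀ s : Finset ℕ, (∀ n ∈ s, m ≤ n) → ∀ k, ‖∑ n ∈ s, f n k‖ ≤ ε) :
    TendstoUniformly (fun (s : Finset ℕ) k => ∑ n ∈ s, f n k) (fun k => ∑' n, f n k) atTop := by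
  have hsum : ∀ k, Summable fun n => f n k := by
    intro k
    rw [summable_iff_vanishing_norm]
    intro ε hε
    obtain ⟨m, hm⟩ := hf (ε / 2) (half_pos hε)
    refine ⟨Finset.range m, fun t ht => (hm t (fun n hn => ?_) k).trans_lt (half_lt_self hε)⟩
    by_contra hlt
    exact Finset.disjoint_left.1 ht hn (Finset.mem_range.2 (not_le.1 hlt))
  rw [Metric.tendstoUniformly_iff]
  intro ε hε
  obtain ⟨m, hm⟩ := hf (ε / 2) (half_pos hε)
  filter_upwards [eventually_ge_atTop (Finset.range m)] with s hs k
  refine lt_of_le_of_lt ?_ (half_lt_self hε)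
  refine le_of_tendsto (((hsum k).hasSum).dist tendsto_const_nhds) ?_
  filter_upwards [eventually_ge_atTop s] with t ht
  rw [dist_eq_norm, ← Finset.sum_sdiff ht, add_sub_cancel_right]
  refine hm _ (fun n hn => ?_) k
  by_contra hlt
  exact (Finset.mem_sdiff.1 hn).2 (hs (Finset.mem_range.2 (not_le.1 hlt)))

/-- A nonzero profile `a` of `r` along `h` forces `h` to be transversal to every `g n`, because `r`
has profile zero there. Adding back the removed terms keeps `a`, so it is a profile of every
residual and maximality gives `‖a‖ ≤ 2 * ‖w m‖`. -/
theorem IsGreedyFamily.dDeltaNull_of_approx {D : Set (Z ≃ₗᵢ[𝕜] Z)} {v : ℕ → Z}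
    {g : ℕ → ℕ → (Z ≃ₗᵢ[𝕜] Z)} {w : ℕ → Z} [NormedSpace ℝ Z] [UniformConvexSpace Z]
    [CompleteSpace Z] {D₀ : Subgroup (Z ≃ₗᵢ[𝕜] Z)} {C : ℝ}
    (hG : IsGreedyFamily D v g w) (hD₀ : IsDislocationGroup D₀)
    (hD : D ⊆ (D₀ : Set (Z ≃ₗᵢ[𝕜] Z))) (hv : ∀ k, ‖v k‖ ≤ C)
    (hw : ∀ ε : ℝ, 0 < ε → ∃ m, ∀ n, m ≤ n → ‖w n‖ ≤ ε)
    {r : ℕ → Z} {C' : ℝ} (hrb : ∀ k, ‖r k‖ ≤ C')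
    (hr : ∀ ε : ℝ, 0 < ε → ∃ m₀, ∀ m, m₀ ≤ m → ∀ᶠ k in atTop,
      ‖v k - ∑ j ∈ Finset.range m, g j k (w j) - r k‖ ≤ ε) :
    DDeltaNull D r := by
  intro h hh
  have H1 : ∀ n, DeltaTendsto (fun k => (g n k)⁻¹ (r k)) 0 := by
    intro n
    refine DeltaAlong.of_approx fun ε hε => ?_
    obtain ⟨m₀, hm₀⟩ := hr ε hε
    refine ⟨_, hG.deltaTendsto_inv_residual hD₀ hD hv (m := n) (n := max m₀ (n + 1))
      (lt_of_lt_of_le n.lt_succ_self (le_max_right _ _)), ?_⟩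
    filter_upwards [hm₀ _ (le_max_left m₀ (n + 1))] with k hk
    rwa [← map_sub, LinearIsometryEquiv.norm_map]
  by_contra hcon
  simp only [DeltaTendsto, not_forall, exists_prop] at hcon
  obtain ⟨y, ε, hε, hcon⟩ := hcon
  rw [not_eventually] at hcon
  have hne : (atTop ⊓ 𝓟 {k | ¬ ‖(h k)⁻¹ (r k) - 0‖ ≤ ‖(h k)⁻¹ (r k) - y‖ + ε}).NeBot :=
    frequently_mem_iff_neBot.1 hcon
  obtain ⟨l', hl', hne', hcg', a, ha⟩ := exists_le_deltaAlong
    (atTop ⊓ 𝓟 {k | ¬ ‖(h k)⁻¹ (r k) - 0‖ ≤ ‖(h k)⁻¹ (r k) - y‖ + ε})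
    (u := fun k => (h k)⁻¹ (r k)) (C := C') (fun k => by simpa using hrb k)
  have ha0 : a ≠ 0 := by
    rintro rfl
    obtain ⟨k, h1, h2⟩ := ((ha y ε hε).and
      (hl' (mem_inf_of_right (mem_principal_self _)))).exists
    exact h2 h1
  obtain ⟨ψ, hψ⟩ := exists_seq_tendsto l'
  have hψt : Tendsto ψ atTop atTop := hψ.mono_right (hl'.trans inf_le_left)
  have haψ : DeltaTendsto (fun k => (h (ψ k))⁻¹ (r (ψ k))) a := ha.comp hψ
  have hhD : ∀ k, h (ψ k) ∈ D₀ := fun k => hD (hh _)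
  have hgD : ∀ n k, g n (ψ k) ∈ D₀ := fun n k => hD (hG.mem n _)
  have H2 : ∀ n, WeakOpNull fun k => (h (ψ k))⁻¹ * g n (ψ k) := by
    intro n
    have h1 := hD₀.weakOpNull_inv_mul (v := fun k => r (ψ k)) (fun k => hrb _) hhD (hgD n) ha0
      haψ ((H1 n).comp hψt)
    have h2 := hD₀.weakOpNull_inv (fun k => D₀.mul_mem (D₀.inv_mem (hgD n k)) (hhD k)) h1
    simpa only [mul_inv_rev, inv_inv] using h2
  have H3 : ∀ m, DeltaTendsto
      (fun k => (h (ψ k))⁻¹ (v (ψ k) - ∑ j ∈ Finset.range m, g j (ψ k) (w j))) a := by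
    intro m
    refine DeltaAlong.of_approx fun ε hε => ?_
    obtain ⟨m₀, hm₀⟩ := hr ε hε
    have h0 : DeltaTendsto (fun k => (h (ψ k))⁻¹ (r (ψ k) - h (ψ k) a)) 0 := by
      have := (deltaAlong_atTop.2 haψ).const_add (-a)
      rw [add_neg_cancel] at this
      simpa only [map_sub, LinearIsometryEquiv.inv_apply_apply, ← sub_eq_add_neg] using
        deltaAlong_atTop.1 this
    have h1 := hD₀.deltaTendsto_inv_add_sum hhD h0 hgD (c := w) (Finset.Ico m (max m₀ m))
      fun n _ _ => H2 n
    have h2 := (deltaAlong_atTop.2 h1).const_add a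
    rw [zero_add] at h2
    refine ⟨_, h2, ?_⟩
    filter_upwards [hψt.eventually (hm₀ _ (le_max_left m₀ m))] with k hk
    rw [Finset.sum_Ico_eq_sub _ (le_max_right m₀ m)]
    have e : ∀ s t : Z, (h (ψ k))⁻¹ (r (ψ k) - h (ψ k) a + (s - t)) + a
        - (h (ψ k))⁻¹ (v (ψ k) - t) = (h (ψ k))⁻¹ (-(v (ψ k) - s - r (ψ k))) := by
      intro s t
      simp only [map_sub, map_add, map_neg, LinearIsometryEquiv.inv_apply_apply]
      abel
    rwa [e, LinearIsometryEquiv.norm_map, norm_neg]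
  obtain ⟨m, hm⟩ := hw (‖a‖ / 4) (by positivity)
  have h5 := hG.maximal (m + 1) m.succ_ne_zero ψ _ a hψt (fun k => hh (ψ k)) (H3 (m + 1))
  have h6 := hm (m + 1) m.le_succ
  linarith [norm_pos_iff.2 ha0]

/-- Existence of `Δ`-profile decompositions of bounded sequences. -/
theorem IsDislocationGroup.exists_deltaProfileDecomposition [NormedSpace ℝ Z]
    [UniformConvexSpace Z] [CompleteSpace Z] {D₀ : Subgroup (Z ≃ₗᵢ[𝕜] Z)}
    (hD₀ : IsDislocationGroup D₀) {D : Set (Z ≃ₗᵢ[𝕜] Z)} (hD : D ⊆ (D₀ : Set (Z ≃ₗᵢ[𝕜] Z)))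
    (hone : 1 ∈ D) {v : ℕ → Z} {C : ℝ} (hv : ∀ k, ‖v k‖ ≤ C) :
    ∃ φ N g w r, IsDeltaProfileDecomposition D v φ N g w r := by
  obtain ⟨φ₁, hφ₁, g₁, w, hG₁⟩ := IsGreedyFamily.exists_comp hone hv
  -- Compactness of a countable product makes all residual norms converge along one subsequence.
  obtain ⟨ρ, -, φ₂, hφ₂, hρ⟩ := (isCompact_univ_pi fun s : Finset ℕ =>
      isCompact_Icc (a := 0) (b := C + ∑ n ∈ s, ‖w n‖)).tendsto_subseq
    (x := fun k s => ‖v (φ₁ k) - ∑ j ∈ s, g₁ j k (w j)‖)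
    fun k s _ => ⟨norm_nonneg _, norm_sub_sum_le (fun k => hv (φ₁ k)) g₁ w s k⟩
  rw [tendsto_pi_nhds] at hρ
  have hG := hG₁.comp hφ₂.tendsto_atTop
  have hv' : ∀ k, ‖v (φ₁ (φ₂ k))‖ ≤ C := fun k => hv _
  set v' : ℕ → Z := fun k => v (φ₁ (φ₂ k)) with hv'def
  set g : ℕ → ℕ → (Z ≃ₗᵢ[𝕜] Z) := fun n k => g₁ n (φ₂ k) with hgdef
  have htail : ∀ ε : ℝ, 0 < ε → ∃ m, ∀ s : Finset ℕ, (∀ n ∈ s, m ≤ n) →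
      ∀ᶠ k in atTop, ‖∑ n ∈ s, g n k (w n)‖ ≤ ε := fun ε hε =>
    hD₀.exists_forall_eventually_norm_sum_le (fun n k => hD (hG.mem n k))
      (fun m n hm hn hmn => hG.weakOpNull hD₀ hD hv' hmn (Or.inr hm) (Or.inr hn))
      (fun s n hn hwn => hG.deltaTendsto_inv_sub_sum hD₀ hD hv' s hn hwn) hρ hε
  obtain ⟨K, hK⟩ := exists_forall_norm_sum_max_le htail
  have hsum := tendstoUniformly_sum_tsum hK
  set S : ℕ → Z := fun k => ∑' n, g n (max k (K n)) (w n) with hS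
  have hmod : ∀ n, ∀ᶠ k in atTop, max k (K n) = k := fun n =>
    (eventually_ge_atTop (K n)).mono fun k hk => max_eq_left hk
  have hnear : ∀ ε : ℝ, 0 < ε → ∃ m₀, ∀ m, m₀ ≤ m → ∀ k,
      ‖∑ j ∈ Finset.range m, g j (max k (K j)) (w j) - S k‖ ≤ ε := by
    intro ε hε
    obtain ⟨s, hs⟩ := eventually_atTop.1 ((Metric.tendstoUniformly_iff.1 hsum) ε hε)
    obtain ⟨m₀, hm₀⟩ := s.exists_nat_subset_range
    refine ⟨m₀, fun m hm k => ?_⟩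
    have := (hs (Finset.range m) (hm₀.trans (Finset.range_mono hm)) k).le
    rwa [dist_comm, dist_eq_norm] at this
  have hnull : DDeltaNull D fun k => v' k - S k := by
    obtain ⟨m₁, hm₁⟩ := hnear 1 one_pos
    refine hG.dDeltaNull_of_approx hD₀ hD hv' (fun ε hε => ?_)
      (C' := C + (∑ j ∈ Finset.range m₁, ‖w j‖ + 1)) (fun k => ?_) fun ε hε => ?_
    · obtain ⟨m, hm⟩ := htail ε hε
      refine ⟨m, fun n hn => ?_⟩
      obtain ⟨k, hk⟩ := (hm {n} (by simpa using hn)).exists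
      simpa using hk
    · refine (norm_sub_le _ _).trans (add_le_add (hv' k) ?_)
      have h1 := hm₁ m₁ le_rfl k
      have h2 : ‖∑ j ∈ Finset.range m₁, g j (max k (K j)) (w j)‖ ≤
          ∑ j ∈ Finset.range m₁, ‖w j‖ :=
        (norm_sum_le _ _).trans_eq
          (Finset.sum_congr rfl fun n _ => LinearIsometryEquiv.norm_map _ _)
      have h3 := norm_sub_le (∑ j ∈ Finset.range m₁, g j (max k (K j)) (w j))
        (∑ j ∈ Finset.range m₁, g j (max k (K j)) (w j) - S k)
      rw [sub_sub_cancel] at h3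
      linarith
    · obtain ⟨m₀, hm₀⟩ := hnear ε hε
      refine ⟨m₀, fun m hm => ?_⟩
      have : ∀ᶠ k in atTop, ∀ j ∈ Finset.range m, max k (K j) = k := by
        rw [Filter.eventually_all_finset]
        exact fun j _ => hmod j
      filter_upwards [this] with k hk
      have h1 := hm₀ m hm k
      rw [Finset.sum_congr rfl fun j hj => by rw [hk j hj]] at h1
      rwa [sub_sub_sub_cancel_left, norm_sub_rev]
  -- `N` is the first nonzero index with vanishing profile, or `⊤` if there is none. Thus slot `0`
  -- is always kept, even when `w 0 = 0`.
  refine ⟨fun k => φ₁ (φ₂ k), ⨅ (n : ℕ) (_ : n ≠ 0 ∧ w n = 0), (n : ℕ∞),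
    fun n k => g n (max k (K n)), w, fun k => v' k - S k, hφ₁.comp hφ₂, ?_,
    fun n k => hG.mem n _, fun k => hG.first_eq_one _, fun n hn => ?_,
    fun m n hm hn hmn => ?_, ?_, hnull⟩
  · exact le_iInf₂ fun n hn => by exact_mod_cast Nat.one_le_iff_ne_zero.2 hn.1
  · by_contra hwn
    have : ((n + 1 : ℕ) : ℕ∞) ≤ ⨅ (n : ℕ) (_ : n ≠ 0 ∧ w n = 0), (n : ℕ∞) := by
      refine le_iInf₂ fun m hm => ?_
      rw [Nat.cast_le]
      by_contra hlt
      exact hwn (hG.eq_zero_of_le hm.1 hm.2 (by omega))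
    exact absurd (Nat.cast_le.1 (this.trans hn)) (by omega)
  · have key : ∀ n : ℕ, (n : ℕ∞) < ⨅ (n : ℕ) (_ : n ≠ 0 ∧ w n = 0), (n : ℕ∞) →
        n = 0 ∨ w n ≠ 0 := by
      intro n hn
      by_contra! hcon
      exact absurd (iInf₂_le (f := fun (n : ℕ) (_ : n ≠ 0 ∧ w n = 0) => (n : ℕ∞)) n hcon)
        (not_le.2 hn)
    refine (hG.weakOpNull hD₀ hD hv' hmn (key m hm) (key n hn)).congr' ?_
    filter_upwards [hmod m, hmod n] with k hkm hkn
    rw [hkm, hkn]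
  · simpa only [sub_sub_cancel, hv'def] using hsum

end Existence

/-! ### Profiles as `Δ`-limits and the energy inequality. -/

section Energy

variable {𝕜 Z : Type*} [RCLike 𝕜] [NormedAddCommGroup Z] [NormedSpace 𝕜 Z]

/-- Energy estimate for the removal of a single concentration. -/
theorem DeltaTendsto.energy_step [NormedSpace ℝ Z] [UniformConvexSpace Z] {v : ℕ → Z}
    {g : ℕ → (Z ≃ₗᵢ[𝕜] Z)} {w : Z} (h : DeltaTendsto (fun k => (g k)⁻¹ (v k)) w)
    (hv : ∀ᶠ k in atTop, ‖v k‖ ≤ 1) :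
    (∀ᶠ k in atTop, ‖v k - g k w‖ ≤ 1) ∧ ∀ ε : ℝ, 0 < ε →
      ∀ᶠ k in atTop, ‖v k - g k w‖ + convexityModulus Z ‖w‖ ≤ ‖v k‖ + ε := by
  by_cases hw : w = 0
  · subst hw
    simp only [map_zero, sub_zero, norm_zero, convexityModulus_zero, add_zero]
    exact ⟨hv, fun ε hε => Eventually.of_forall fun k => by linarith⟩
  obtain ⟨η, hη, huc⟩ := exists_forall_norm_half_add_le (E := Z) 1 (norm_pos_iff.2 hw)
  have hmid : ∀ ε : ℝ, 0 < ε → ∀ᶠ k in atTop,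
      ‖v k - g k w‖ ≤ ‖v k + (v k - g k w)‖ / 2 + ε := by
    intro ε hε
    filter_upwards [h ((1 / 2 : 𝕜) • w) ε hε] with k hk
    rw [LinearIsometryEquiv.norm_inv_apply_sub, LinearIsometryEquiv.norm_inv_apply_sub] at hk
    have e : v k - g k ((1 / 2 : 𝕜) • w) = (1 / 2 : 𝕜) • (v k + (v k - g k w)) := by
      rw [map_smul]
      module
    rw [e, norm_smul] at hk
    have e3 : ‖(1 / 2 : 𝕜)‖ = 1 / 2 := by simp
    rw [e3] at hk
    linarith
  -- The exact inequality, without an error term, puts both points in the ball of radius `‖v k‖`, so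
  -- no continuity of the modulus is needed.
  have hle : ∀ᶠ k in atTop, ‖v k - g k w‖ ≤ ‖v k‖ := by
    filter_upwards [h 0 η hη, hmid (η / 2) (half_pos hη), hv] with k hk1 hk2 hk3
    rw [LinearIsometryEquiv.norm_inv_apply_sub, LinearIsometryEquiv.norm_inv_apply_sub,
      map_zero, sub_zero] at hk1
    have := huc ‖v k‖ hk3 (v k) (v k - g k w) (by linarith) hk1
      (by rw [sub_sub_cancel, LinearIsometryEquiv.norm_map])
    linarith
  refine ⟨?_, fun ε hε => ?_⟩
  · filter_upwards [hle, hv] with k h1 h2 using h1.trans h2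
  · filter_upwards [hle, hv, hmid ε hε] with k h1 h2 h3
    have := convexityModulus_le_sub h2 le_rfl h1
    rw [sub_sub_cancel, LinearIsometryEquiv.norm_map] at this
    linarith

namespace IsDeltaProfileDecomposition

variable {D : Set (Z ≃ₗᵢ[𝕜] Z)} {D₀ : Subgroup (Z ≃ₗᵢ[𝕜] Z)} {u : ℕ → Z} {φ : ℕ → ℕ} {N : ℕ∞}
  {g : ℕ → ℕ → (Z ≃ₗᵢ[𝕜] Z)} {w r : ℕ → Z} (h : IsDeltaProfileDecomposition D u φ N g w r)
include h

theorem lt_of_ne_zero {n : ℕ} (hn : w n ≠ 0) : (n : ℕ∞) < N := by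
  by_contra hlt
  exact hn (h.profile_eq_zero n (not_lt.1 hlt))

theorem exists_forall_norm_le {ε : ℝ} (hε : 0 < ε) :
    ∃ t : Finset ℕ, ∀ s, t ⊆ s → ∀ k, ‖u (φ k) - r k - ∑ n ∈ s, g n k (w n)‖ ≤ ε := by
  obtain ⟨t, ht⟩ := eventually_atTop.1 ((Metric.tendstoUniformly_iff.1 h.sum) ε hε)
  exact ⟨t, fun s hs k => by simpa [dist_eq_norm] using (ht s hs k).le⟩

variable (hD₀ : IsDislocationGroup D₀) (hD : D ⊆ (D₀ : Set (Z ≃ₗᵢ[𝕜] Z)))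
include hD₀ hD

/-- Up to a uniformly small tail, what remains besides `g n k (w n)` is the remainder plus finitely
many concentrations transversal to `g n`. -/
theorem deltaTendsto_inv_sub_sum {n : ℕ} (hn : (n : ℕ∞) < N) {s : Finset ℕ} (hns : n ∉ s) :
    DeltaTendsto (fun k => (g n k)⁻¹ (u (φ k) - ∑ j ∈ s, g j k (w j))) (w n) := by
  refine DeltaAlong.of_approx fun ε hε => ?_
  obtain ⟨t, ht⟩ := h.exists_forall_norm_le hε
  have h1 := hD₀.deltaTendsto_inv_add_sum (fun k => hD (h.mem n k))
    (h.remainder.deltaTendsto (h.mem n)) (fun m k => hD (h.mem m k)) (c := w)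
    ((insert n (t ∪ s) \ s).erase n) fun m hm hwm =>
      h.decoupled m n (h.lt_of_ne_zero hwm) hn (Finset.ne_of_mem_erase hm)
  have h2 := (deltaAlong_atTop.2 h1).const_add (w n)
  rw [zero_add] at h2
  refine ⟨_, h2, Eventually.of_forall fun k => ?_⟩
  have h3 := ht (insert n (t ∪ s)) (Finset.subset_union_left.trans (Finset.subset_insert _ _)) k
  have h4 : s ⊆ insert n (t ∪ s) := Finset.subset_union_right.trans (Finset.subset_insert _ _)
  have h5 : n ∈ insert n (t ∪ s) \ s := Finset.mem_sdiff.2 ⟨Finset.mem_insert_self _ _, hns⟩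
  rw [← Finset.sum_sdiff h4, ← Finset.add_sum_erase _ _ h5] at h3
  have e : ∀ a b : Z, (g n k)⁻¹ (r k + a) + w n - (g n k)⁻¹ (u (φ k) - b)
      = (g n k)⁻¹ (-(u (φ k) - r k - (g n k (w n) + a + b))) := by
    intro a b
    simp only [map_sub, map_add, map_neg, LinearIsometryEquiv.inv_apply_apply]
    abel
  rwa [e, LinearIsometryEquiv.norm_map, norm_neg]

theorem deltaTendsto_profile {n : ℕ} (hn : (n : ℕ∞) < N) :
    DeltaTendsto (fun k => (g n k)⁻¹ (u (φ k))) (w n) := by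
  simpa using h.deltaTendsto_inv_sub_sum hD₀ hD hn (Finset.notMem_empty n)

theorem norm_profile_le (hu : ∀ k, ‖u k‖ ≤ 1) (n : ℕ) : ‖w n‖ ≤ 2 := by
  by_cases hn : (n : ℕ∞) < N
  · have := DeltaAlong.norm_le (C := 1) (deltaAlong_atTop.2 (h.deltaTendsto_profile hD₀ hD hn))
      (Eventually.of_forall fun k => by simpa using hu (φ k))
    linarith
  · simp [h.profile_eq_zero n (not_lt.1 hn)]

variable [NormedSpace ℝ Z] [UniformConvexSpace Z] (hu : ∀ k, ‖u k‖ ≤ 1)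
include hu

theorem energy_partial (m : ℕ) :
    (∀ᶠ k in atTop, ‖u (φ k) - ∑ j ∈ Finset.range m, g j k (w j)‖ ≤ 1) ∧ ∀ ε : ℝ, 0 < ε →
      ∀ᶠ k in atTop, ‖u (φ k) - ∑ j ∈ Finset.range m, g j k (w j)‖
        + ∑ j ∈ Finset.range m, convexityModulus Z ‖w j‖ ≤ 1 + ε := by
  induction m with
  | zero =>
    simp only [Finset.range_zero, Finset.sum_empty, sub_zero, add_zero]
    exact ⟨Eventually.of_forall fun k => hu _,
      fun ε hε => Eventually.of_forall fun k => by linarith [hu (φ k)]⟩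
  | succ m ih =>
    simp only [Finset.sum_range_succ, ← sub_sub]
    by_cases hm : (m : ℕ∞) < N
    · obtain ⟨h1, h2⟩ := (h.deltaTendsto_inv_sub_sum hD₀ hD hm
        (Finset.notMem_range_self (n := m))).energy_step ih.1
      refine ⟨h1, fun ε hε => ?_⟩
      filter_upwards [ih.2 (ε / 2) (half_pos hε), h2 (ε / 2) (half_pos hε)] with k hk1 hk2
      linarith
    · simpa [h.profile_eq_zero m (not_lt.1 hm)] using ih

theorem sum_convexityModulus_le (m : ℕ) :
    ∑ j ∈ Finset.range m, convexityModulus Z ‖w j‖ ≤ 1 := by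
  refine le_of_forall_pos_le_add fun ε hε => ?_
  obtain ⟨k, hk⟩ := ((h.energy_partial hD₀ hD hu m).2 ε hε).exists
  linarith [norm_nonneg (u (φ k) - ∑ j ∈ Finset.range m, g j k (w j))]

theorem summable_convexityModulus : Summable fun n => convexityModulus Z ‖w n‖ :=
  summable_of_sum_range_le (fun _ => convexityModulus_nonneg _)
    (h.sum_convexityModulus_le hD₀ hD hu)

theorem limsup_add_tsum_le :
    limsup (fun k => ‖r k‖) atTop + ∑' n, convexityModulus Z ‖w n‖ ≤ 1 := by
  rw [← le_sub_iff_add_le]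
  refine le_of_forall_pos_le_add fun ε hε => ?_
  obtain ⟨t, ht⟩ := h.exists_forall_norm_le (show 0 < ε / 3 by positivity)
  obtain ⟨m₀, hm₀⟩ := t.exists_nat_subset_range
  have h1 := (h.summable_convexityModulus hD₀ hD hu).hasSum.tendsto_sum_nat.eventually_const_lt
    (show _ - ε / 3 < _ from sub_lt_self _ (by positivity))
  obtain ⟨m, hm, hm'⟩ := (h1.and (eventually_ge_atTop m₀)).exists
  refine limsup_le_of_le (isCoboundedUnder_le_of_le atTop (x := 0) fun k => norm_nonneg _) ?_
  filter_upwards [(h.energy_partial hD₀ hD hu m).2 (ε / 3) (by positivity)] with k hk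
  have h2 := ht _ (hm₀.trans (Finset.range_mono hm')) k
  have h3 := norm_sub_le (u (φ k) - ∑ j ∈ Finset.range m, g j k (w j))
    (u (φ k) - r k - ∑ j ∈ Finset.range m, g j k (w j))
  have e : u (φ k) - ∑ j ∈ Finset.range m, g j k (w j)
      - (u (φ k) - r k - ∑ j ∈ Finset.range m, g j k (w j)) = r k := by abel
  rw [e] at h3
  linarith

end IsDeltaProfileDecomposition

end Energy

/-! ### Weak sequential compactness from uniform convexity and smoothness. -/

section WeakCompactness

variable {𝕜 Z : Type*} [RCLike 𝕜] [NormedAddCommGroup Z] [NormedSpace 𝕜 Z]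

/-- In a complete uniformly convex space every functional attains its norm. -/
theorem exists_apply_eq_one [NormedSpace ℝ Z] [UniformConvexSpace Z] [CompleteSpace Z]
    {f : StrongDual 𝕜 Z} (hf : ‖f‖ = 1) : ∃ z : Z, ‖z‖ = 1 ∧ f z = 1 := by
  have hx : ∀ n : ℕ, ∃ (z : Z) (t : ℝ), ‖z‖ ≤ 1 ∧ 1 - 1 / ((n : ℝ) + 1) < t ∧ f z = (t : 𝕜) := by
    intro n
    obtain ⟨x, hx, hfx⟩ := f.exists_lt_apply_of_lt_opNorm
      (r := 1 - 1 / ((n : ℝ) + 1)) (by rw [hf]; exact sub_lt_self _ Nat.one_div_pos_of_nat)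
    obtain ⟨c, hc, hcx⟩ := RCLike.exists_norm_eq_mul_self (f x)
    exact ⟨c • x, ‖f x‖, by rw [norm_smul, hc, one_mul]; exact hx.le, hfx, by
      rw [map_smul, smul_eq_mul, hcx]⟩
  choose z t hz ht hfz using hx
  have ht1 : ∀ n, t n ≤ 1 := by
    intro n
    have h1 := f.le_opNorm (z n)
    rw [hfz, hf, one_mul, RCLike.norm_ofReal] at h1
    exact (le_abs_self _).trans (h1.trans (hz n))
  have hcauchy : CauchySeq z := by
    rw [Metric.cauchySeq_iff]
    intro ε hε
    obtain ⟨η, hη, h⟩ := exists_forall_norm_half_add_le (E := Z) 1 hε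
    obtain ⟨N, hN⟩ := exists_nat_one_div_lt hη
    refine ⟨N, fun i hi j hj => ?_⟩
    by_contra hlt
    rw [not_lt, dist_eq_norm] at hlt
    have hi' := Nat.one_div_le_one_div (α := ℝ) hi
    have hj' := Nat.one_div_le_one_div (α := ℝ) hj
    have h4 := h 1 le_rfl (z i) (z j) (by linarith [hz i]) (by linarith [hz j]) hlt
    have h5 := f.le_opNorm (z i + z j)
    rw [map_add, hfz, hfz, hf, one_mul, ← RCLike.ofReal_add, RCLike.norm_ofReal] at h5
    linarith [le_abs_self (t i + t j), ht i, ht j]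
  obtain ⟨z₀, hz₀⟩ := cauchySeq_tendsto_of_complete hcauchy
  have htlim : Tendsto t atTop (𝓝 1) := by
    refine tendsto_of_tendsto_of_tendsto_of_le_of_le (g := fun n : ℕ => 1 - 1 / ((n : ℝ) + 1)) ?_
      tendsto_const_nhds (fun n => (ht n).le) ht1
    simpa using (tendsto_one_div_add_atTop_nhds_zero_nat (𝕜 := ℝ)).const_sub 1
  have hf1 : f z₀ = 1 := by
    have h1 := (f.continuous.tendsto z₀).comp hz₀
    have h2 := ((RCLike.continuous_ofReal (K := 𝕜)).tendsto 1).comp htlim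
    have h3 : (f ∘ z) = RCLike.ofReal ∘ t := funext hfz
    rw [h3] at h1
    simpa using tendsto_nhds_unique h1 h2
  refine ⟨z₀, le_antisymm (le_of_tendsto' hz₀.norm hz) ?_, hf1⟩
  have := f.le_opNorm z₀
  rwa [hf1, hf, norm_one, one_mul] at this

/-- In a uniformly smooth space the norming functionals depend uniformly continuously on the
points of the unit sphere. -/
theorem IsUniformlySmooth.exists_forall_norm_sub_le (hsmooth : IsUniformlySmooth Z) {ε : ℝ}
    (hε : 0 < ε) : ∃ δ : ℝ, 0 < δ ∧ ∀ (f g : StrongDual 𝕜 Z) (z z' : Z), ‖f‖ = 1 → ‖g‖ = 1 →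
      ‖z‖ = 1 → f z = 1 → g z' = 1 → ‖z - z'‖ ≤ δ → ‖f - g‖ ≤ ε := by
  obtain ⟨t, ht, h⟩ := hsmooth (ε / 2) (half_pos hε)
  refine ⟨ε / 2 * t, by positivity, fun f g z z' hf hg hz hfz hgz hzz' => ?_⟩
  refine ContinuousLinearMap.opNorm_le_of_unit_norm hε.le fun x hx => ?_
  obtain ⟨c, hc, hcx⟩ := RCLike.exists_norm_eq_mul_self ((f - g) x)
  -- The phase `c` makes `(f - g) y = t * ‖(f - g) x‖`. Evaluating `f` at `z + y` and `g` at `z' -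
  -- y` bounds this by `(ε / 2) * t` from smoothness plus `‖z - z'‖`.
  set y : Z := (t : 𝕜) • c • x with hy
  have hyn : ‖y‖ = t := by
    rw [hy, norm_smul, norm_smul, hc, hx, RCLike.norm_ofReal, abs_of_pos ht, one_mul, mul_one]
  have h1 : RCLike.re (f (z + y)) ≤ ‖z + y‖ :=
    (RCLike.re_le_norm _).trans (by simpa [hf] using f.le_opNorm (z + y))
  have h2 : RCLike.re (g (z' - y)) ≤ ‖z' - y‖ :=
    (RCLike.re_le_norm _).trans (by simpa [hg] using g.le_opNorm (z' - y))
  have h3 : RCLike.re (f (z + y)) + RCLike.re (g (z' - y)) = 2 + t * ‖(f - g) x‖ := by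
    have e : f (z + y) + g (z' - y) = ((2 + t * ‖(f - g) x‖ : ℝ) : 𝕜) := by
      rw [RCLike.ofReal_add, RCLike.ofReal_mul, hcx, RCLike.ofReal_ofNat]
      simp only [hy, map_add, map_sub, map_smul, hfz, hgz, smul_eq_mul, sub_apply]
      ring
    rw [← map_add, e, RCLike.ofReal_re]
  have h4 := h z y hz hyn.le
  have h5 := norm_sub_le (z - y) (z - z')
  rw [sub_sub_sub_cancel_left] at h5
  rw [hyn] at h4
  refine le_of_mul_le_mul_left (a := t) ?_ ht
  linarith

/-- A decreasing sequence of nonempty bounded closed convex sets in a complete uniformly convex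
space has a common point. -/
theorem exists_forall_mem_of_antitone [NormedSpace ℝ Z] [UniformConvexSpace Z] [CompleteSpace Z]
    {S : ℕ → Set Z} (hanti : Antitone S) (hne : ∀ n, (S n).Nonempty) (hconv : ∀ n, Convex ℝ (S n))
    (hclosed : ∀ n, IsClosed (S n)) {R : ℝ} (hR : ∀ n, ∀ z ∈ S n, ‖z‖ ≤ R) :
    ∃ z, ∀ n, z ∈ S n := by
  set d : ℕ → ℝ := fun n => Metric.infDist 0 (S n) with hd
  have hdmono : Monotone d := fun i j hij => Metric.infDist_le_infDist_of_subset (hanti hij) (hne j)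
  have hdle : ∀ n, ∀ z ∈ S n, d n ≤ ‖z‖ := fun n z hz => by
    simpa [hd] using Metric.infDist_le_dist_of_mem (x := 0) hz
  have hdbdd : BddAbove (Set.range d) := by
    refine ⟨R, ?_⟩
    rintro _ ⟨n, rfl⟩
    obtain ⟨z, hz⟩ := hne n
    exact (hdle n z hz).trans (hR n z hz)
  have hdlim := tendsto_atTop_ciSup hdmono hdbdd
  have hz : ∀ n : ℕ, ∃ z ∈ S n, ‖z‖ < d n + 1 / ((n : ℝ) + 1) := by
    intro n
    obtain ⟨z, hz, hz'⟩ := (Metric.infDist_lt_iff (hne n)).1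
      (lt_add_of_pos_right (d n) (Nat.one_div_pos_of_nat (α := ℝ) (n := n)))
    exact ⟨z, hz, by simpa using hz'⟩
  choose z hzS hzn using hz
  -- Nearly norm-minimal points are Cauchy: a midpoint of two distant ones would lie in the set
  -- below its distance to `0`.
  have hcauchy : CauchySeq z := by
    rw [Metric.cauchySeq_iff']
    intro ε hε
    obtain ⟨η, hη, h⟩ := exists_forall_norm_half_add_le (E := Z) (⨆ n, d n) hε
    obtain ⟨N, hN⟩ := exists_nat_one_div_lt hη
    obtain ⟨M, hM⟩ := (hdlim.eventually_const_lt (sub_lt_self _ hη)).exists_forall_of_atTop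
    refine ⟨max N M, fun i hi => ?_⟩
    by_contra hlt
    rw [not_lt, dist_eq_norm] at hlt
    have hi' := Nat.one_div_le_one_div (α := ℝ) ((le_max_left N M).trans hi)
    have hj' := Nat.one_div_le_one_div (α := ℝ) (le_max_left N M)
    have h4 := h _ le_rfl (z i) (z (max N M))
      (by linarith [hzn i, le_ciSup hdbdd i])
      (by linarith [hzn (max N M), le_ciSup hdbdd (max N M)]) hlt
    have hmid : (1 / 2 : ℝ) • z i + (1 / 2 : ℝ) • z (max N M) ∈ S (max N M) :=
      hconv _ (hanti hi (hzS i)) (hzS _) (by norm_num) (by norm_num) (by norm_num)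
    have h5 := hdle _ _ hmid
    rw [← smul_add, norm_smul, Real.norm_of_nonneg (by norm_num)] at h5
    linarith [hM _ (le_max_right N M)]
  obtain ⟨z₀, hz₀⟩ := cauchySeq_tendsto_of_complete hcauchy
  refine ⟨z₀, fun n => (hclosed n).mem_of_tendsto hz₀ ?_⟩
  filter_upwards [eventually_ge_atTop n] with i hi using hanti hi (hzS i)

/-- Unit functionals attain their norm, so by smoothness the norming functionals of a countable
dense subset of the sphere approximate them all. A diagonal subsequence thus converges under every
functional; a common point of the closed convex hulls of its tails is the weak limit. -/
theorem exists_weakTendsto_of_separable [NormedSpace ℝ Z] [UniformConvexSpace Z] [CompleteSpace Z]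
    [TopologicalSpace.SeparableSpace Z] (hsmooth : IsUniformlySmooth Z) {u : ℕ → Z} {C : ℝ}
    (hu : ∀ k, ‖u k‖ ≤ C) :
    ∃ ψ : ℕ → ℕ, StrictMono ψ ∧ ∃ x, WeakTendsto 𝕜 (fun k => u (ψ k)) x := by
  have hC : 0 ≤ C := (norm_nonneg _).trans (hu 0)
  obtain ⟨c, hcs, hcc, hcd⟩ := (TopologicalSpace.IsSeparable.of_separableSpace
    (Metric.sphere (0 : Z) 1)).exists_countable_dense_subset
  have hc1 : ∀ z : c, ‖(z : Z)‖ = 1 := fun z => by simpa using hcs z.2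
  choose F hF hFz using fun z : c => exists_dual_vector 𝕜 (z : Z) (by rw [hc1]; exact one_ne_zero)
  have := hcc.to_subtype
  obtain ⟨L, -, ψ, hψ, hL⟩ := (isCompact_univ_pi fun z : c =>
      isCompact_closedBall (0 : 𝕜) C).tendsto_subseq (x := fun k z => F z (u k)) fun k z _ => by
    have := (F z).le_opNorm (u k)
    rw [hF, one_mul] at this
    simpa using this.trans (hu k)
  rw [tendsto_pi_nhds] at hL
  refine ⟨ψ, hψ, ?_⟩
  have hone : ∀ f : StrongDual 𝕜 Z, ‖f‖ = 1 → CauchySeq fun k => f (u (ψ k)) := by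
    intro f hf
    obtain ⟨z, hz, hfz⟩ := exists_apply_eq_one hf
    rw [Metric.cauchySeq_iff]
    intro ε hε
    obtain ⟨δ, hδ, h⟩ := hsmooth.exists_forall_norm_sub_le (𝕜 := 𝕜)
      (show 0 < ε / (4 * (C + 1)) by positivity)
    obtain ⟨z', hz', hzz'⟩ := Metric.mem_closure_iff.1 (hcd (show z ∈ _ by simpa using hz)) δ hδ
    have hFf := h f (F ⟨z', hz'⟩) z z' hf (hF _) hz hfz
      (by rw [hFz, hc1]; simp) (by rw [← dist_eq_norm]; exact hzz'.le)
    have hsmall : ∀ k, ‖f (u k) - F ⟨z', hz'⟩ (u k)‖ ≤ ε / 4 := by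
      intro k
      have h1 := (f - F ⟨z', hz'⟩).le_opNorm (u k)
      refine h1.trans ?_
      calc _ ≤ ε / (4 * (C + 1)) * (C + 1) := by
            gcongr
            linarith [hu k]
        _ = ε / 4 := by field_simp
    obtain ⟨N, hN⟩ := Metric.cauchySeq_iff.1 (hL ⟨z', hz'⟩).cauchySeq (ε / 4) (by positivity)
    refine ⟨N, fun i hi j hj => ?_⟩
    have h1 := hN i hi j hj
    have h2 := dist_triangle4 (f (u (ψ i))) (F ⟨z', hz'⟩ (u (ψ i))) (F ⟨z', hz'⟩ (u (ψ j)))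
      (f (u (ψ j)))
    have h3 := hsmall (ψ i)
    have h4 := hsmall (ψ j)
    rw [← dist_eq_norm] at h3 h4
    rw [dist_comm (F ⟨z', hz'⟩ (u (ψ j)))] at h2
    simp only [Function.comp] at h1
    linarith
  have hlim : ∀ f : StrongDual 𝕜 Z, ∃ L, Tendsto (fun k => f (u (ψ k))) atTop (𝓝 L) := by
    intro f
    by_cases hf : f = 0
    · exact ⟨0, by simp [hf]⟩
    have hfn : ‖f‖ ≠ 0 := norm_ne_zero_iff.2 hf
    obtain ⟨L, hL⟩ := cauchySeq_tendsto_of_complete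
      (hone (((‖f‖⁻¹ : ℝ) : 𝕜) • f) (by
        rw [norm_smul, RCLike.norm_ofReal, abs_of_nonneg (by positivity), inv_mul_cancel₀ hfn]))
    refine ⟨(‖f‖ : 𝕜) * L, (hL.const_mul (‖f‖ : 𝕜)).congr fun k => ?_⟩
    have hfn' : (‖f‖ : 𝕜) ≠ 0 := by exact_mod_cast hfn
    rw [smul_apply, smul_eq_mul, RCLike.ofReal_inv, mul_inv_cancel_left₀ hfn']
  obtain ⟨x, hx⟩ := exists_forall_mem_of_antitone (R := C)
    (S := fun n => closure (convexHull ℝ ((fun k => u (ψ k)) '' Set.Ici n)))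
    (fun i j hij => closure_mono (convexHull_mono (Set.image_mono (Set.Ici_subset_Ici.2 hij))))
    (fun n => ⟨u (ψ n), subset_closure (subset_convexHull ℝ _ ⟨n, Set.self_mem_Ici, rfl⟩)⟩)
    (fun n => (convex_convexHull ℝ _).closure) (fun n => isClosed_closure) (by
      intro n z hz
      have : closure (convexHull ℝ ((fun k => u (ψ k)) '' Set.Ici n)) ⊆ Metric.closedBall 0 C := by
        refine closure_minimal (convexHull_min ?_ (convex_closedBall _ _)) Metric.isClosed_closedBall
        rintro _ ⟨k, -, rfl⟩
        simpa using hu (ψ k)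
      simpa using this hz)
  refine ⟨x, fun f => ?_⟩
  obtain ⟨L, hL⟩ := hlim f
  have hfx : f x = L := by
    refine eq_of_forall_dist_le fun ε hε => ?_
    obtain ⟨n, hn⟩ := ((Metric.tendsto_nhds.1 hL) ε hε).exists_forall_of_atTop
    have hsub : closure (convexHull ℝ ((fun k => u (ψ k)) '' Set.Ici n)) ⊆
        f ⁻¹' Metric.closedBall L ε := by
      refine closure_minimal (convexHull_min ?_ ?_)
        (Metric.isClosed_closedBall.preimage f.continuous)
      · rintro _ ⟨k, hk, rfl⟩
        exact (hn k hk).le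
      · intro a ha b hb s t hs ht hst
        have := convex_closedBall L ε ha hb hs ht hst
        simpa only [Set.mem_preimage, map_add, map_real_smul f f.continuous] using this
    exact hsub (hx n)
  rwa [hfx]

end WeakCompactness

/-! ### Weak limits, and `Δ`-limits under Opial's condition. -/

section WeakLimits

variable {𝕜 Z : Type*} [RCLike 𝕜] [NormedAddCommGroup Z] [NormedSpace 𝕜 Z]

theorem Submodule.uniformConvexSpace [UniformConvexSpace Z] (p : Submodule 𝕜 Z) :
    UniformConvexSpace p where
  uniform_convex ε hε := by
    obtain ⟨δ, hδ, h⟩ := exists_forall_sphere_dist_add_le_two_sub Z hε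
    exact ⟨δ, hδ, fun x hx y hy hxy => h (x := (x : Z)) hx (y := (y : Z)) hy hxy⟩

theorem IsUniformlySmooth.submodule (h : IsUniformlySmooth Z) (p : Submodule 𝕜 Z) :
    IsUniformlySmooth p := by
  intro ε hε
  obtain ⟨δ, hδ, h⟩ := h ε hε
  exact ⟨δ, hδ, fun x y hx hy => h (x : Z) (y : Z) hx hy⟩

/-- Bounded sequences in uniformly convex and uniformly smooth Banach spaces have weakly
convergent subsequences. -/
theorem exists_weakTendsto [UniformConvexSpace Z] [CompleteSpace Z]
    (hsmooth : IsUniformlySmooth Z) {u : ℕ → Z} {C : ℝ} (hu : ∀ k, ‖u k‖ ≤ C) :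
    ∃ ψ : ℕ → ℕ, StrictMono ψ ∧ ∃ x, WeakTendsto 𝕜 (fun k => u (ψ k)) x := by
  set p : Submodule 𝕜 Z := (Submodule.span 𝕜 (Set.range u)).topologicalClosure with hp
  have hup : ∀ k, u k ∈ p := fun k =>
    Submodule.le_topologicalClosure _ (Submodule.subset_span ⟨k, rfl⟩)
  let : NormedSpace ℝ p := NormedSpace.restrictScalars ℝ 𝕜 p
  have := p.uniformConvexSpace
  have : CompleteSpace p := (Submodule.isClosed_topologicalClosure _).completeSpace_coe
  have : TopologicalSpace.SeparableSpace p :=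
    ((Set.countable_range u).isSeparable.span (R := 𝕜)).closure.separableSpace
  obtain ⟨ψ, hψ, x, hx⟩ := exists_weakTendsto_of_separable (𝕜 := 𝕜) (hsmooth.submodule p)
    (u := fun k => (⟨u k, hup k⟩ : p)) (C := C) hu
  exact ⟨ψ, hψ, x, fun f => hx (f.comp p.subtypeL)⟩

/-- Under Opial's condition, bounded `Δ`-convergent sequences converge weakly. -/
theorem SatisfiesOpial.weakTendsto [UniformConvexSpace Z] [CompleteSpace Z]
    (hO : SatisfiesOpial 𝕜 Z) (hsmooth : IsUniformlySmooth Z) {u : ℕ → Z} {C : ℝ}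
    (hu : ∀ k, ‖u k‖ ≤ C) {a : Z} (ha : DeltaTendsto u a) : WeakTendsto 𝕜 u a := by
  let : NormedSpace ℝ Z := NormedSpace.restrictScalars ℝ 𝕜 Z
  intro f
  by_contra hcon
  obtain ⟨s, hs, hfreq⟩ := not_tendsto_iff_exists_frequently_notMem.1 hcon
  obtain ⟨ψ₁, hψ₁, hψs⟩ := extraction_of_frequently_atTop hfreq
  obtain ⟨ψ₂, hψ₂, x, hx⟩ := exists_weakTendsto (𝕜 := 𝕜) hsmooth (fun k => hu (ψ₁ k))
  obtain ⟨ρ, hρC, ψ₃, hψ₃, hρ⟩ := (isCompact_Icc (a := 0) (b := C + ‖a‖)).tendsto_subseq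
    (x := fun k => ‖u (ψ₁ (ψ₂ k)) - a‖)
    fun k => ⟨norm_nonneg _, (norm_sub_le _ _).trans (by gcongr; exact hu _)⟩
  have hψ := hψ₁.tendsto_atTop.comp (hψ₂.tendsto_atTop.comp hψ₃.tendsto_atTop)
  have hxψ : WeakTendsto 𝕜 (fun k => u (ψ₁ (ψ₂ (ψ₃ k)))) x := fun f =>
    (hx f).comp hψ₃.tendsto_atTop
  have haψ : DeltaTendsto (fun k => u (ψ₁ (ψ₂ (ψ₃ k)))) a := ha.comp hψ
  have hxa : x ≠ a := by
    rintro rfl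
    obtain ⟨k, hk⟩ := ((hxψ f).eventually hs).exists
    exact hψs _ hk
  -- Opial makes `x` frequently almost as close as `a`, so by uniform convexity their midpoint is
  -- strictly closer, which a `Δ`-limit `a` forbids.
  obtain ⟨η, hη, huc⟩ := exists_forall_norm_half_add_le (E := Z) (C + ‖a‖)
    (norm_sub_pos_iff.2 hxa)
  have hρ' : Tendsto (fun k => ‖u (ψ₁ (ψ₂ (ψ₃ k))) - a‖) atTop (𝓝 ρ) := hρ
  have h1 := hO _ x hxψ a
  rw [hρ'.liminf_eq] at h1
  have h2 : ∃ᶠ k in atTop, ‖u (ψ₁ (ψ₂ (ψ₃ k))) - x‖ < ρ + η / 2 := by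
    refine frequently_lt_of_liminf_lt ?_ (lt_of_le_of_lt h1 (by linarith))
    refine isCoboundedUnder_ge_of_le atTop (x := C + ‖x‖) fun k => ?_
    exact (norm_sub_le _ _).trans (by gcongr; exact hu _)
  obtain ⟨k, hk1, hk2, hk3⟩ := (h2.and_eventually
    ((hρ'.eventually_const_lt (show ρ - η / 2 < ρ by linarith)).and
      (haψ ((1 / 2 : ℝ) • (a + x)) (η / 2) (half_pos hη)))).exists
  have h4 := huc ‖u (ψ₁ (ψ₂ (ψ₃ k))) - a‖
    ((norm_sub_le _ _).trans (by gcongr; exact hu _)) (u (ψ₁ (ψ₂ (ψ₃ k))) - a)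
    (u (ψ₁ (ψ₂ (ψ₃ k))) - x) (by linarith) (by linarith) (by rw [sub_sub_sub_cancel_left])
  have e : u (ψ₁ (ψ₂ (ψ₃ k))) - a + (u (ψ₁ (ψ₂ (ψ₃ k))) - x)
      = (2 : ℝ) • (u (ψ₁ (ψ₂ (ψ₃ k))) - (1 / 2 : ℝ) • (a + x)) := by module
  rw [e, norm_smul, Real.norm_ofNat] at h4
  linarith

/-- Weak limits of images of bounded sequences lie in the closure of the image of a ball. -/
theorem WeakTendsto.mem_closure_image_closedBall {X : Type*} [NormedAddCommGroup X]
    [NormedSpace 𝕜 X] (ι : X →L[𝕜] Z) {x : ℕ → X} {R : ℝ} (hx : ∀ k, ‖x k‖ ≤ R) {z : Z}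
    (hz : WeakTendsto 𝕜 (fun k => ι (x k)) z) : z ∈ closure (ι '' Metric.closedBall 0 R) := by
  let : NormedSpace ℝ Z := NormedSpace.restrictScalars ℝ 𝕜 Z
  let : NormedSpace ℝ X := NormedSpace.restrictScalars ℝ 𝕜 X
  by_contra hmem
  have hconv : Convex ℝ (ι '' Metric.closedBall 0 R) := by
    rintro _ ⟨a, ha, rfl⟩ _ ⟨b, hb, rfl⟩ s t hs ht hst
    exact ⟨s • a + t • b, convex_closedBall _ _ ha hb hs ht hst, by
      rw [map_add, map_real_smul ι ι.continuous, map_real_smul ι ι.continuous]⟩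
  obtain ⟨f, c, hfc, hcz⟩ := RCLike.geometric_hahn_banach_closed_point (𝕜 := 𝕜) hconv.closure
    isClosed_closure hmem
  have h1 := (RCLike.continuous_re.tendsto (f z)).comp (hz f)
  obtain ⟨k, hk⟩ := (h1.eventually_const_lt hcz).exists
  exact lt_asymm hk (hfc _ (subset_closure ⟨x k, by simpa using hx k, rfl⟩))

theorem DWeakNull.congr_of_tendsto {D : Set (Z ≃ₗᵢ[𝕜] Z)} {u v : ℕ → Z} (hu : DWeakNull D u)
    (huv : Tendsto (fun k => v k - u k) atTop (𝓝 0)) : DWeakNull D v := by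
  intro g hg f
  have h1 : Tendsto (fun k => (g k)⁻¹ (v k - u k)) atTop (𝓝 0) := by
    rw [tendsto_zero_iff_norm_tendsto_zero] at huv ⊢
    simpa only [LinearIsometryEquiv.norm_map] using huv
  have h2 := (hu g hg f).add ((f.continuous.tendsto 0).comp h1)
  simpa [Function.comp_def] using h2

end WeakLimits

/-! ### Vanishing of the remainder under cocompactness. -/

section Cocompactness

variable {𝕜 X Y : Type*} [RCLike 𝕜] [NormedAddCommGroup X] [NormedSpace 𝕜 X]
  [NormedAddCommGroup Y] [NormedSpace 𝕜 Y]

/-- Bounded sequences in `X` which are `D`-weakly null in `Y` converge to zero in `Y`, if the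
embedding is `D`-cocompact. -/
theorem IsDCocompact.tendsto_zero {ι : X →L[𝕜] Y} {D : Set (Y ≃ₗᵢ[𝕜] Y)} (h : IsDCocompact ι D)
    (hone : 1 ∈ D) {x : ℕ → X} {C : ℝ} (hx : ∀ k, ‖x k‖ ≤ C)
    (hnull : DWeakNull D fun k => ι (x k)) : Tendsto (fun k => ι (x k)) atTop (𝓝 0) := by
  rcases h with h | ⟨hd, h⟩
  · obtain ⟨l, hl⟩ := h (Metric.closedBall 0 C) Metric.isBounded_closedBall (fun k => ι (x k))
      (fun k => ⟨x k, by simpa using hx k, rfl⟩) 0 (by simpa using hnull)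
    have hl0 : l = 0 := by
      refine SeparatingDual.eq_zero_of_forall_dual_eq_zero (R := 𝕜) fun f => ?_
      have h1 := hnull (fun _ => 1) (fun _ => hone) f
      rw [map_zero] at h1
      exact tendsto_nhds_unique ((f.continuous.tendsto l).comp hl) 
        (by simpa [Function.comp_def] using h1)
    rwa [hl0] at hl
  -- Functionals on `X` are approximated by functionals on `Y`; boundedness in `X` controls the
  -- error.
  · refine h x fun g hg f => ?_
    choose G hGD hG using hg
    have hC : 0 ≤ C := (norm_nonneg _).trans (hx 0)
    rw [map_zero, tendsto_zero_iff_norm_tendsto_zero, Metric.tendsto_nhds]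
    intro ε hε
    obtain ⟨f', hf'⟩ := hd.exists_dist_lt f (show 0 < ε / (2 * (C + 1)) by positivity)
    have h1 := hnull G hGD f'
    rw [map_zero] at h1
    filter_upwards [(Metric.tendsto_nhds.1 h1) (ε / 2) (half_pos hε)] with k hk
    have h2 : ι ((g k)⁻¹ (x k)) = (G k)⁻¹ (ι (x k)) := by
      have := hG k ((g k)⁻¹ (x k))
      rw [LinearIsometryEquiv.apply_inv_apply] at this
      rw [this, LinearIsometryEquiv.inv_apply_apply]
    have h3 := (f - f'.comp ι).le_opNorm ((g k)⁻¹ (x k))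
    rw [LinearIsometryEquiv.norm_map] at h3
    have h4 : ‖f - f'.comp ι‖ * ‖x k‖ ≤ ε / 2 := by
      calc _ ≤ ε / (2 * (C + 1)) * (C + 1) := by
            gcongr
            · exact (dist_eq_norm f _ ▸ hf').le
            · linarith [hx k]
        _ = ε / 2 := by field_simp
    have h5 := norm_sub_le_norm_sub_add_norm_sub (f ((g k)⁻¹ (x k))) (f' (ι ((g k)⁻¹ (x k)))) 0
    rw [dist_zero_right, ← h2] at hk
    rw [sub_zero, sub_zero] at h5
    rw [dist_zero_right, norm_norm]
    have h6 : (f - f'.comp ι) ((g k)⁻¹ (x k)) = f ((g k)⁻¹ (x k)) - f' (ι ((g k)⁻¹ (x k))) := rfl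
    rw [h6] at h3
    linarith

/-- If finitely many profiles are nonzero, then the remainder vanishes asymptotically under
Opial's condition and cocompactness. -/
theorem IsDeltaProfileDecomposition.tendsto_remainder_zero [UniformConvexSpace Y]
    [CompleteSpace Y] (hsmooth : IsUniformlySmooth Y) {ι : X →L[𝕜] Y}
    {D₀ : Subgroup (Y ≃ₗᵢ[𝕜] Y)} (hD₀ : IsDislocationGroup D₀)
    (hrestr : ∀ g ∈ D₀, ∃ h : X ≃ₗᵢ[𝕜] X, IsRestriction ι g h)
    {D : Set (Y ≃ₗᵢ[𝕜] Y)} (hD : D ⊆ (D₀ : Set (Y ≃ₗᵢ[𝕜] Y))) (hone : 1 ∈ D)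
    {u : ℕ → X} {C : ℝ} (hu : ∀ k, ‖u k‖ ≤ C) {φ : ℕ → ℕ} {N : ℕ∞}
    {g : ℕ → ℕ → (Y ≃ₗᵢ[𝕜] Y)} {w r : ℕ → Y}
    (h : IsDeltaProfileDecomposition D (fun k => ι (u k)) φ N g w r)
    (hfin : {n | w n ≠ 0}.Finite) (hO : SatisfiesOpial 𝕜 Y) (hco : IsDCocompact ι D) :
    Tendsto r atTop (𝓝 0) := by
  have hC : 0 ≤ C := (norm_nonneg _).trans (hu 0)
  have hιu : ∀ x : X, ‖x‖ ≤ C → ‖ι x‖ ≤ ‖ι‖ * C := fun x hx => ι.le_opNorm_of_le hx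
  set s : Finset ℕ := hfin.toFinset with hs
  have hr : ∀ k, r k = ι (u (φ k)) - ∑ n ∈ s, g n k (w n) := by
    intro k
    have h1 : ∀ ε : ℝ, 0 < ε → ‖ι (u (φ k)) - r k - ∑ n ∈ s, g n k (w n)‖ ≤ ε := by
      intro ε hε
      obtain ⟨t, ht⟩ := h.exists_forall_norm_le hε
      have h2 := ht (t ∪ s) Finset.subset_union_left k
      rwa [← Finset.sum_subset (Finset.subset_union_right (s₁ := t) (s₂ := s)) fun n _ hn => by
        have : w n = 0 := by simpa [hs] using hn
        rw [this, map_zero]] at h2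
    have h3 := norm_le_zero_iff.1 (le_of_forall_pos_le_add fun ε hε => by
      simpa using h1 ε hε)
    have h4 := sub_eq_zero.1 h3
    rw [← h4]
    abel
  have hrb : ∀ k, ‖r k‖ ≤ ‖ι‖ * C + ∑ n ∈ s, ‖w n‖ := fun k => by
    rw [hr]
    exact norm_sub_sum_le (v := fun k => ι (u (φ k))) (fun k => hιu _ (hu _)) g w s k
  have hrnull : DWeakNull D r := fun G hG =>
    hO.weakTendsto hsmooth (fun k => by simpa using hrb k) (h.remainder G hG)
  choose H hH using fun n k => hrestr (g n k) (hD (h.mem n k))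
  have hHinv : ∀ n k x, ι ((H n k)⁻¹ x) = (g n k)⁻¹ (ι x) := by
    intro n k x
    have := hH n k ((H n k)⁻¹ x)
    rw [LinearIsometryEquiv.apply_inv_apply] at this
    rw [this, LinearIsometryEquiv.inv_apply_apply]
  have hcl : ∀ n, w n ∈ closure (ι '' Metric.closedBall 0 C) := by
    intro n
    by_cases hn : (n : ℕ∞) < N
    · have h1 := hO.weakTendsto hsmooth (C := ‖ι‖ * C) (fun k => by simpa using hιu _ (hu (φ k)))
        (h.deltaTendsto_profile hD₀ hD hn)
      refine WeakTendsto.mem_closure_image_closedBall (𝕜 := 𝕜) ι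
        (x := fun k => (H n k)⁻¹ (u (φ k))) (fun k => by simpa using hu (φ k)) ?_
      simpa only [hHinv] using h1
    · rw [h.profile_eq_zero n (not_lt.1 hn)]
      exact subset_closure ⟨0, by simpa using hC, map_zero ι⟩
  have hy : ∀ n, ∃ y : ℕ → X, (∀ k, ‖y k‖ ≤ C) ∧ Tendsto (fun k => ι (y k)) atTop (𝓝 (w n)) := by
    intro n
    obtain ⟨z, hz, hzw⟩ := mem_closure_iff_seq_limit.1 (hcl n)
    choose y hy hyz using hz
    exact ⟨y, fun k => by simpa using hy k, by simpa only [hyz] using hzw⟩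
  choose y hyC hyw using hy
  -- The profiles need not lie in `X`; bounded approximants from `X` replace them, moved by the
  -- restricted gauges.
  set x : ℕ → X := fun k => u (φ k) - ∑ n ∈ s, H n k (y n k) with hx
  have hxC : ∀ k, ‖x k‖ ≤ C + ∑ _n ∈ s, C := fun k => by
    refine (norm_sub_le _ _).trans (add_le_add (hu _) ((norm_sum_le _ _).trans
      (Finset.sum_le_sum fun n _ => ?_)))
    rw [LinearIsometryEquiv.norm_map]
    exact hyC n k
  have hdiff : Tendsto (fun k => ι (x k) - r k) atTop (𝓝 0) := by
    have h1 : ∀ k, ι (x k) - r k = ∑ n ∈ s, g n k (w n - ι (y n k)) := by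
      intro k
      simp only [hx, hr, map_sub, map_sum, hH _ _ _, Finset.sum_sub_distrib]
      abel
    simp only [h1]
    have h2 : ∀ n ∈ s, Tendsto (fun k => g n k (w n - ι (y n k))) atTop (𝓝 0) := by
      intro n _
      rw [tendsto_zero_iff_norm_tendsto_zero]
      simp only [LinearIsometryEquiv.norm_map]
      rw [← tendsto_zero_iff_norm_tendsto_zero]
      simpa using (hyw n).const_sub (w n)
    simpa using tendsto_finsetSum s h2
  have h1 := hco.tendsto_zero hone hxC (hrnull.congr_of_tendsto hdiff)
  simpa using h1.sub hdiff

end Cocompactness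

theorem mainTheorem10 {𝕜 X Y : Type*} [RCLike 𝕜]
    [NormedAddCommGroup X] [NormedSpace 𝕜 X] [CompleteSpace X]
    [NormedAddCommGroup Y] [NormedSpace 𝕜 Y] [CompleteSpace Y]
    [UniformConvexSpace Y] (hsmooth : IsUniformlySmooth Y)
    (ι : X →L[𝕜] Y) (hι : Function.Injective ι) (hdense : DenseRange ι)
    (D₀ : Subgroup (Y ≃ₗᵢ[𝕜] Y)) (hD₀ : IsDislocationGroup D₀)
    (hrestr : ∀ g ∈ D₀, ∃ h : X ≃ₗᵢ[𝕜] X, IsRestriction ι g h)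
    (hD₀X : IsDislocationGroup (restrictGroup ι D₀))
    (D : Set (Y ≃ₗᵢ[𝕜] Y)) (hD : D ⊆ (D₀ : Set (Y ≃ₗᵢ[𝕜] Y))) (hone : 1 ∈ D)
    (u : ℕ → X) (hu : Bornology.IsBounded (Set.range u)) :
    (∃ φ N g w r, IsDeltaProfileDecomposition D (fun k => ι (u k)) φ N g w r) ∧
    ∀ φ N g w r, IsDeltaProfileDecomposition D (fun k => ι (u k)) φ N g w r →
      (∀ n : ℕ, (n : ℕ∞) < N → DeltaTendsto (fun k => (g n k)⁻¹ (ι (u (φ k)))) (w n)) ∧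
      ((∀ k, ‖ι (u k)‖ ≤ 1) →
        (∀ n, ‖w n‖ ≤ 2) ∧
        Summable (fun n => convexityModulus Y ‖w n‖) ∧
        limsup (fun k => ‖r k‖) atTop + ∑' n, convexityModulus Y ‖w n‖ ≤ 1) ∧
      ({n | w n ≠ 0}.Finite → SatisfiesOpial 𝕜 Y → IsDCocompact ι D →
        Tendsto r atTop (𝓝 0)) := by
  let : NormedSpace ℝ Y := NormedSpace.restrictScalars ℝ 𝕜 Y
  obtain ⟨C, hC⟩ := hu.exists_norm_le
  have hC' : ∀ k, ‖u k‖ ≤ C := fun k => hC _ ⟨k, rfl⟩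
  refine ⟨hD₀.exists_deltaProfileDecomposition hD hone fun k => ι.le_opNorm_of_le (hC' k),
    fun φ N g w r h => ⟨fun n hn => h.deltaTendsto_profile hD₀ hD hn, fun h1 => ⟨?_, ?_, ?_⟩,
      fun hfin hO hco => h.tendsto_remainder_zero hsmooth hD₀ hrestr hD hone hC' hfin hO hco⟩⟩
  · exact h.norm_profile_le hD₀ hD h1
  · exact h.summable_convexityModulus hD₀ hD h1
  · exact h.limsup_add_tsum_le hD₀ hD h1
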